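/- Let $p$ be an odd prime, $g\ge 1$, and let $f\in\mathbb{Z}_p[x]$ be monic of degree $2g+1$ with separable reduction modulo $p$; let $C$ be the hyperelliptic curve $y^2=f(x)$. Let $P=(x(P),y(P))$ and $Q=(x(Q),y(Q))$ be points of $C$ with coordinates in $\mathbb{Z}_p$ and with $y(P),y(Q)\in\mathbb{Z}_p^\times$ (points in finite non-Weierstrass residue discs). Let $\omega$ and $\beta$ be the differentials with residue divisors $(P)-(-P)$ and $(Q)-(-Q)$ given by $$\omega=\frac{y(P)\,dx}{y\,(x-x(P))}+\frac{h_\omega(x)\,dx}{y},\qquad \beta=\frac{y(Q)\,dx}{y\,(x-x(Q))}+\frac{h_\beta(x)\,dx}{y},$$ where $h_\omega,h_\beta\in\mathbb{Z}_p[x]$ have degree less than $g$ (for instance $h_\omega=h_\beta=0$). Let $\phi$ be the lift of the $p$-power Frobenius with $\phi(x)=x^p$ and $$\frac1{\phi(y)}=y^{-p}\sum_{i\ge 0}\binom{-1/2}{i}\left(\frac{f(x^p)-f(x)^p}{y^{2p}}\right)^i,$$ and let $\alpha=\phi^*\omega-p\,\omega$. Let $K$ be a complete non-archimedean extension field of $\mathbb{Q}_p$,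 with norm normalized by $|p|=1/p$, and let $A=(a,0)$, $a\in K$, be a finite Weierstrass point of $C$ (that is, $f(a)=0$) with $A\neq(0,0)$. Then there is a unique $x(t)\in K[[t]]$ with $x(0)=a$ and $f(x(t))=t^2$; let $(x(t),y(t))$, with $y(t)=t$, be the resulting local coordinates at $A$. Substituting them, and $dx=x'(t)\,dt$, into the formulas above, one obtains $\alpha$ as a two-sided Laurent series in $t$ times $dt$ (each of whose coefficients is a convergent series in $K$), and $\beta$ as a series in $t$ times $dt$ without a term in $t^{-1}dt$; let $\int\beta$ be its formal primitive, with any constant of integration. The series for $\mathrm{Res}_A(\alpha\int\beta)$, the coefficient of $t^{-1}dt$ in $\alpha\int\beta$, converges in $K$. To compute $\mathrm{Res}_A(\alpha\int\beta)$ to $n\ge 1$ $p$-adic digits, it suffices to compute the local coordinates to precision $t^{2pn-p-3}$. Precisely: let $M\ge 2pn-p-3$, and let $\tilde x(t)$ be the truncation of $x(t)$ modulo $t^M$. If $(x(t),t)$ is replaced by $(\tilde x(t),t)$ in the same formulas for $\alpha$ and $\beta$, and the constant of integration is replaced by any other one, then all the series still converge, there is still no term in $t^{-1}dt$ in $\beta$,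 and the resulting value $R_M\in K$ of the residue satisfies $$\Bigl|\mathrm{Res}_A\bigl(\alpha\textstyle\int\beta\bigr)-R_M\Bigr|\le p^{-n}.$$ -/

import Mathlib

open scoped PowerSeries Polynomial

noncomputable section

namespace HyperellipticResidue

/-- The structure map `ℤ_p → ℚ_p → K` of a field extension `K` of `ℚ_p`. -/
def padicIntTo (p : ℕ) [Fact p.Prime] (K : Type*) [NormedField K] [NormedAlgebra ℚ_[p] K] :
    ℤ_[p] →+* K :=
  (algebraMap ℚ_[p] K).comp (algebraMap ℤ_[p] ℚ_[p])

section

variable {K : Type*} [NormedField K]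

/-- `(x(t), y(t))` are the local coordinates, with parameter `t = y`, of the curve `y² = F(x)` at the
finite Weierstrass point `(a, 0)`. -/
structure IsLocalCoordinates (F : K[X]) (a : K) (x y : K⟦X⟧) : Prop where
  parameter : y = PowerSeries.X
  center : PowerSeries.constantCoeff x = a
  curve : y ^ 2 = Polynomial.aeval x F

/-- The data of a differential with residue divisor `(P) - (-P)`, `P = (xP, yP)`, namely of
`yP dx / (y (x - xP)) + hol(x) dx / y`, where `hol` is a polynomial (of degree less than the genus). -/
structure Diff (K : Type*) [NormedField K] where
  xP : K
  yP : K
  hol : K[X]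

/-- The image of a power series in the field of Laurent series. -/
def toL (x : K⟦X⟧) : LaurentSeries K := HahnSeries.ofPowerSeries ℤ K x

/-- The series `u(t)` such that the differential is `u(t) dt` when `(x(t), y(t))` is substituted
for `(x, y)`, with `dx = x'(t) dt`. -/
def Diff.expand (ω : Diff K) (x y : K⟦X⟧) : LaurentSeries K :=
  (HahnSeries.C ω.yP * (toL x - HahnSeries.C ω.xP)⁻¹ + Polynomial.aeval (toL x) ω.hol) *
    (toL y)⁻¹ * toL (PowerSeries.derivative K x)

/-- The `i`-th term of the binomial expansion of `φ^* ω`, where `φ` is the lift of the `p`-power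
Frobenius with `φ(x) = x^p`, `φ(y)² = F(x^p)`, that is
`1/φ(y) = y^{-p} ∑ᵢ binom(-1/2, i) ((F(x^p) - F(x)^p) / y^{2p})^i`, and
`φ^* ω = (yP / (x^p - xP) + hol(x^p)) · p x^{p-1} dx / φ(y)`,
with `(x(t), y(t))` substituted for `(x, y)`. -/
def Diff.frobeniusTerm (p : ℕ) (F : K[X]) (ω : Diff K) (x y : K⟦X⟧) (i : ℕ) : LaurentSeries K :=
  (HahnSeries.C ω.yP * (toL x ^ p - HahnSeries.C ω.xP)⁻¹ + Polynomial.aeval (toL x ^ p) ω.hol) *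
    ((p : LaurentSeries K) * toL x ^ (p - 1) * toL (PowerSeries.derivative K x)) *
    ((toL y ^ p)⁻¹ * HahnSeries.C ((Ring.choose (-1 / 2 : ℚ) i : ℚ) : K) *
      ((Polynomial.aeval (toL x ^ p) F - Polynomial.aeval (toL x) F ^ p) * (toL y ^ (2 * p))⁻¹) ^ i)

/-- The coefficients of `α = φ^* ω - p ω` as a two-sided Laurent series in `t`: `α` is
`∑ₖ (alphaCoeff k) t^k dt` on an annulus `r < |t| < 1`. -/
def alphaCoeff (p : ℕ) (F : K[X]) (ω : Diff K) (x y : K⟦X⟧) (k : ℤ) : K :=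
  (∑' i : ℕ, (ω.frobeniusTerm p F x y i).coeff k) - (p : K) * (ω.expand x y).coeff k

/-- The coefficients of the primitive `∫ β`, with constant of integration `c`; here `β` has no term
in `t⁻¹ dt`. -/
def primitiveCoeff (β : Diff K) (c : K) (x y : K⟦X⟧) (k : ℤ) : K :=
  if k = 0 then c else (β.expand x y).coeff (k - 1) / (k : K)

/-- `Res (α ∫ β)`, the coefficient of `t⁻¹ dt` in the product of the two expansions. -/
def residue (p : ℕ) (F : K[X]) (ω β : Diff K) (c : K) (x y : K⟦X⟧) : K :=
  ∑' k : ℤ, alphaCoeff p F ω x y (-1 - k) * primitiveCoeff β c x y k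

/-- All the series that enter `Res (α ∫ β)` converge, and `∫ β` has no logarithmic term. -/
structure ResidueConverges (p : ℕ) (F : K[X]) (ω β : Diff K) (c : K) (x y : K⟦X⟧) : Prop where
  summable_alpha : ∀ k : ℤ, Summable fun i : ℕ => (ω.frobeniusTerm p F x y i).coeff k
  no_log : (β.expand x y).coeff (-1) = 0
  summable_residue :
    Summable fun k : ℤ => alphaCoeff p F ω x y (-1 - k) * primitiveCoeff β c x y k

end

/-- The differential with the given data over `ℤ_p`, over the extension `K` of `ℚ_p`. -/
def diffOfPadicInt {p : ℕ} [Fact p.Prime] (K : Type*) [NormedField K] [NormedAlgebra ℚ_[p] K]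
    (xP yP : ℤ_[p]) (hol : ℤ_[p][X]) : Diff K :=
  ⟨padicIntTo p K xP, padicIntTo p K yP, hol.map (padicIntTo p K)⟩

end HyperellipticResidue

end

open scoped PowerSeries Polynomial

noncomputable section

namespace HyperellipticResidue

open scoped NNReal

/-! ### Laurent series filtered jointly by powers of `t` and of `p` -/

section Filtration

variable {K : Type*} [NormedField K]

/-! Hensel's lemma makes `x(t)` integral, and uniqueness applied to `x(-t)` makes it even. Hence `β`
and `ω` expand as integral power series: the `k`-th coefficient `b_k` of `∫β` has size at most
`|k|⁻¹`, and all negative powers in `α` come from `φ^*ω`. By parity `α` has no term in `t⁻¹ dt`, so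
the constant of integration is irrelevant and the residue is the sum of `α_{-1-k} b_k` over `k ≥ 1`.

The poles of `φ^*ω` are controlled by `Filt` with `q = p⁻¹`. As `f(x^p) - f(x)^p` is divisible by
`p`, dividing it by `t^(2p)` leaves level 0, so `t φ^*ω` has level `p + 2` (`Admissible.filt_term`).
Thus `α_{-1-k}` decays roughly like `p^(-k/(2p))`, which beats `|k|⁻¹ ≤ k` and gives convergence.

Marking the truncated data by primes, the two residues are compared through `α b - α' b' = α (b -
b') + (α - α') b'`, term by term.

For `(α - α') b'`, the difference of the two `t φ^*ω` has level about `2pn - 3`, which yields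
`|α_{-1-k} - α'_{-1-k}| ≤ p⁻ⁿ |k|` because `k ≥ p^v(k)` (`norm_alphaCoeff_sub_le`,
`exponent_bound`). The case `p = 3` needs two more levels, supplied by `filt_theta_sub_trunc`.

For `α (b - b')`, the coefficients agree when `k + 1 < M`. For the remaining `k` one needs
`|α_{-1-k}| ≤ p⁻ⁿ |k|`, that is, `φ^*ω` must have an almost integral primitive
(`norm_alphaCoeff_le_mul_norm`). Put `S = f(x^p) = φ(y)²` and `T = φ(y)`. In its residue disc `S` is
a parameter, so `φ^*ω` is an integral combination of `S^m dS / T = 2 T^(2m) dT = 2 d(T^(2m+1)) /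
(2m+1)`. Differentiation produces the factor `k`, and the high level `(2m+1)p` of `T^(2m+1)` more
than compensates the denominator. This uses `f(x(t)) = t²`, so it is available for the true
coordinates only, which is why `α` and not `α'` multiplies `b - b'`. -/

/-- The Laurent series whose `k`-th coefficient has absolute value at most `q ^ i` for some `i` with
`N ≤ k + 2 p i`. For `q = 0` these are the series `t ^ N u(t)` with `u` an integral power series; for
`q = p⁻¹` both `t ^ (2 p)` and `p` raise the level `N` by `2 p`. -/
def Filt (p : ℕ) (q : ℝ≥0) (N : ℤ) (f : LaurentSeries K) : Prop :=
  ∀ k : ℤ, ∃ i : ℕ, N ≤ k + 2 * p * i ∧ ‖f.coeff k‖₊ ≤ q ^ i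

/-- The Laurent series with coefficients of absolute value at most `r`. -/
def Bdd (r : ℝ) (f : LaurentSeries K) : Prop := ∀ k : ℤ, ‖f.coeff k‖ ≤ r

variable {p : ℕ} {q : ℝ≥0} {N M : ℤ} {f g : LaurentSeries K} {r s : ℝ}

theorem Filt.mono (hf : Filt p q N f) (h : M ≤ N) : Filt p q M f := fun k ↦ by
  obtain ⟨i, h1, h2⟩ := hf k
  exact ⟨i, h.trans h1, h2⟩

theorem Filt.mono_left {q' : ℝ≥0} (hf : Filt p q N f) (h : q ≤ q') : Filt p q' N f := fun k ↦ by
  obtain ⟨i, h1, h2⟩ := hf k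
  exact ⟨i, h1, h2.trans (by gcongr)⟩

theorem exists_le_add_mul [Fact p.Prime] (N k : ℤ) : ∃ i : ℕ, N ≤ k + 2 * p * i := by
  refine ⟨(N - k).toNat, ?_⟩
  have h1 : (1 : ℤ) ≤ p := by exact_mod_cast (Fact.out : p.Prime).one_le
  have h2 := Int.self_le_toNat (N - k)
  have h3 : (0 : ℤ) ≤ ((N - k).toNat : ℤ) := Int.natCast_nonneg _
  nlinarith

theorem Filt.zero [Fact p.Prime] : Filt p q N (0 : LaurentSeries K) := fun k ↦ by
  obtain ⟨i, hi⟩ := exists_le_add_mul (p := p) N k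
  exact ⟨i, hi, by simp⟩

theorem Filt.neg (hf : Filt p q N f) : Filt p q N (-f) := fun k ↦ by
  obtain ⟨i, h1, h2⟩ := hf k
  exact ⟨i, h1, by simpa using h2⟩

theorem filt_of_norm_le_one [Fact p.Prime] (h1 : ∀ k, ‖f.coeff k‖ ≤ 1)
    (h0 : ∀ k < N, f.coeff k = 0) : Filt p q N f := fun k ↦ by
  by_cases hk : k < N
  · obtain ⟨i, hi⟩ := exists_le_add_mul (p := p) N k
    exact ⟨i, hi, by simp [h0 k hk]⟩
  · exact ⟨0, by simpa using hk, by simpa [← NNReal.coe_le_coe] using h1 k⟩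

theorem Filt.norm_coeff_le_one (hf : Filt p q N f) (hq : q ≤ 1) (k : ℤ) : ‖f.coeff k‖ ≤ 1 := by
  obtain ⟨i, -, h2⟩ := hf k
  exact_mod_cast h2.trans (pow_le_one₀ zero_le hq)

/-- The way a level is turned into an estimate: if the exponent `i - 1` is too small to reach level
`N` at `k`, the exponent provided by `Filt` is at least `i`. -/
theorem Filt.norm_coeff_le [Fact p.Prime] (hf : Filt p q N f) (hq : q ≤ 1) {k : ℤ} {i : ℕ}
    (h : k + 2 * p * (i - 1) < N) : ‖f.coeff k‖ ≤ q ^ i := by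
  obtain ⟨j, h1, h2⟩ := hf k
  have h3 : ‖f.coeff k‖ ≤ q ^ j := by exact_mod_cast h2
  refine h3.trans (pow_le_pow_of_le_one q.2 (by exact_mod_cast hq) ?_)
  have hp : (0 : ℤ) < 2 * p := by have := (Fact.out : p.Prime).pos; positivity
  have : (2 * p : ℤ) * (i - 1) < 2 * p * j := by linarith
  have := lt_of_mul_lt_mul_left this hp.le
  omega

theorem Filt.coeff_eq_zero (hf : Filt p 0 N f) {k : ℤ} (hk : k < N) : f.coeff k = 0 := by
  obtain ⟨j, h1, h2⟩ := hf k
  have : j ≠ 0 := by rintro rfl; simp at h1; omega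
  simpa [this] using h2

theorem Filt.bdd (hf : Filt p q N f) (hq : q ≤ 1) : Bdd 1 f := hf.norm_coeff_le_one hq

theorem Bdd.neg (hf : Bdd r f) : Bdd r (-f) := fun k ↦ by simpa using hf k

theorem Bdd.mono (hf : Bdd r f) (h : r ≤ s) : Bdd s f := fun k ↦ (hf k).trans h

theorem bdd_zero (hr : 0 ≤ r) : Bdd r (0 : LaurentSeries K) := fun k ↦ by simpa using hr

theorem filt_C [Fact p.Prime] {c : K} (hc : ‖c‖ ≤ 1) : Filt p q 0 (HahnSeries.C c) :=
  filt_of_norm_le_one (fun k ↦ by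
    by_cases hk : k = 0
    · subst hk; simpa using hc
    · simp [HahnSeries.C_apply, HahnSeries.coeff_single_of_ne hk]) fun k hk ↦ by
    simp [HahnSeries.C_apply, HahnSeries.coeff_single_of_ne hk.ne]

theorem bdd_C {c : K} (hc : ‖c‖ ≤ r) : Bdd r (HahnSeries.C c) := fun k ↦ by
  by_cases hk : k = 0
  · subst hk; simpa using hc
  · simpa [HahnSeries.C_apply, HahnSeries.coeff_single_of_ne hk] using (norm_nonneg c).trans hc

theorem filt_single [Fact p.Prime] (N : ℤ) : Filt p q N (HahnSeries.single N (1 : K)) :=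
  filt_of_norm_le_one (fun k ↦ by
    by_cases hk : k = N
    · subst hk; simp
    · simp [HahnSeries.coeff_single_of_ne hk]) fun k hk ↦ by
    simp [HahnSeries.coeff_single_of_ne hk.ne]

theorem bdd_one : Bdd 1 (1 : LaurentSeries K) := bdd_C (c := 1) (by simp)

variable [IsUltrametricDist K]

theorem Filt.add (hf : Filt p q N f) (hg : Filt p q N g) : Filt p q N (f + g) := fun k ↦ by
  obtain ⟨i, h1, h2⟩ := hf k
  obtain ⟨j, h3, h4⟩ := hg k
  have := IsUltrametricDist.norm_add_le_max (f.coeff k) (g.coeff k)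
  rcases le_max_iff.1 this with h | h
  · exact ⟨i, h1, (by simpa using! h : ‖(f + g).coeff k‖ ≤ _).trans h2⟩
  · exact ⟨j, h3, (by simpa using! h : ‖(f + g).coeff k‖ ≤ _).trans h4⟩

/-- By the ultrametric inequality a single product of coefficients dominates the convolution sum,
and for that product both the degrees and the exponents add. -/
theorem Filt.mul [Fact p.Prime] (hf : Filt p q N f) (hg : Filt p q M g) :
    Filt p q (N + M) (f * g) := fun k ↦ by
  rw [HahnSeries.coeff_mul]
  rcases (Finset.antidiagonal f.isPWO_support g.isPWO_support k).eq_empty_or_nonempty with h | h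
  · obtain ⟨i, hi⟩ := exists_le_add_mul (p := p) (N + M) k
    exact ⟨i, hi, by simp [h]⟩
  · obtain ⟨⟨k1, k2⟩, hk, hle⟩ := IsUltrametricDist.exists_norm_finsetSum_le_of_nonempty h
      fun ij ↦ f.coeff ij.1 * g.coeff ij.2
    obtain ⟨i, h1, h2⟩ := hf k1
    obtain ⟨j, h3, h4⟩ := hg k2
    have hk' : k1 + k2 = k := by simpa using (Finset.mem_antidiagonal.1 hk).2.2
    refine ⟨i + j, ?_, ?_⟩
    · push_cast; linarith
    · refine (show ‖_‖₊ ≤ ‖f.coeff k1 * g.coeff k2‖₊ from hle).trans ?_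
      rw [nnnorm_mul, pow_add]
      gcongr

theorem Filt.pow [Fact p.Prime] (hf : Filt p q N f) (n : ℕ) : Filt p q (n * N) (f ^ n) := by
  induction n with
  | zero => simpa using! filt_C (K := K) (p := p) (q := q) (c := 1) (by simp)
  | succ n ih => simpa [pow_succ, add_mul] using ih.mul hf

theorem Filt.sum [Fact p.Prime] {ι : Type*} {s : Finset ι} {F : ι → LaurentSeries K}
    (h : ∀ i ∈ s, Filt p q N (F i)) : Filt p q N (∑ i ∈ s, F i) :=
  Finset.sum_induction _ _ (fun _ _ ↦ Filt.add) Filt.zero h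

theorem Bdd.add (hf : Bdd r f) (hg : Bdd r g) : Bdd r (f + g) := fun k ↦
  (IsUltrametricDist.norm_add_le_max (f.coeff k) (g.coeff k)).trans (max_le (hf k) (hg k))

theorem Bdd.sub (hf : Bdd r f) (hg : Bdd r g) : Bdd r (f - g) :=
  sub_eq_add_neg f g ▸ hf.add hg.neg

theorem Bdd.mul (hf : Bdd r f) (hg : Bdd s g) : Bdd (r * s) (f * g) := fun k ↦ by
  rw [HahnSeries.coeff_mul]
  have hr : 0 ≤ r := (norm_nonneg _).trans (hf 0)
  have hs : 0 ≤ s := (norm_nonneg _).trans (hg 0)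
  refine IsUltrametricDist.norm_sum_le_of_forall_le_of_nonneg (mul_nonneg hr hs) fun ij _ ↦ ?_
  rw [norm_mul]
  exact mul_le_mul (hf _) (hg _) (norm_nonneg _) hr

theorem Bdd.mul_left (hf : Bdd r f) (hg : Bdd 1 g) : Bdd r (f * g) := by simpa using hf.mul hg

theorem Bdd.mul_right (hf : Bdd 1 f) (hg : Bdd r g) : Bdd r (f * g) := by simpa using hf.mul hg

theorem Bdd.pow (hf : Bdd r f) (n : ℕ) : Bdd (r ^ n) (f ^ n) := by
  induction n with
  | zero => simpa using bdd_one
  | succ n ih => simpa [pow_succ] using ih.mul hf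

end Filtration

/-! ### The derivation `t d/dt` and the involution `t ↦ -t` -/

section Operators

variable {K : Type*} [NormedField K]

/-- Scaling coefficients can shrink supports; a common larger index set allows the convolution sums
before and after scaling to be compared term by term. -/
theorem coeff_mul_of_support_subset {f g : LaurentSeries K} {S T : Set ℤ} (hS : S.IsPWO)
    (hT : T.IsPWO) (hf : f.support ⊆ S) (hg : g.support ⊆ T) (k : ℤ) :
    (f * g).coeff k = ∑ ij ∈ Finset.antidiagonal hS hT k, f.coeff ij.1 * g.coeff ij.2 := by
  rw [HahnSeries.coeff_mul_left' hS hf]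
  refine Finset.sum_subset (fun ij hij ↦ ?_) fun ij hij hn ↦ ?_
  · rw [Finset.mem_antidiagonal] at hij ⊢
    exact ⟨hij.1, hg hij.2.1, hij.2.2⟩
  · rw [Finset.mem_antidiagonal] at hij hn
    have : g.coeff ij.2 = 0 := by
      by_contra h
      exact hn ⟨hij.1, h, hij.2.2⟩
    rw [this, mul_zero]

/-- Multiplication of the `k`-th coefficient by `c k`. -/
def scale (c : ℤ → K) : LaurentSeries K →+ LaurentSeries K where
  toFun f := ⟨fun k ↦ c k * f.coeff k, f.isPWO_support.mono fun _ hk ↦ right_ne_zero_of_mul hk⟩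
  map_zero' := by ext; simp
  map_add' f g := by ext k; simp [mul_add]

@[simp]
theorem coeff_scale (c : ℤ → K) (f : LaurentSeries K) (k : ℤ) :
    (scale c f).coeff k = c k * f.coeff k := rfl

theorem support_scale (c : ℤ → K) (f : LaurentSeries K) : (scale c f).support ⊆ f.support :=
  fun _ hk ↦ right_ne_zero_of_mul hk

/-- The derivation `t d/dt` of the field of Laurent series. -/
def theta : LaurentSeries K →+ LaurentSeries K := scale (fun k ↦ (k : K))

theorem coeff_theta (f : LaurentSeries K) (k : ℤ) : (theta f).coeff k = k * f.coeff k := rfl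

theorem theta_mul (f g : LaurentSeries K) : theta (f * g) = f * theta g + theta f * g := by
  ext k
  rw [coeff_theta, HahnSeries.coeff_add, HahnSeries.coeff_mul,
    coeff_mul_of_support_subset (g := theta g) f.isPWO_support g.isPWO_support subset_rfl
      (support_scale _ _),
    coeff_mul_of_support_subset (f := theta f) f.isPWO_support g.isPWO_support
      (support_scale _ _) subset_rfl,
    Finset.mul_sum, ← Finset.sum_add_distrib]
  refine Finset.sum_congr rfl fun ij hij ↦ ?_
  have : ij.1 + ij.2 = k := (Finset.mem_antidiagonal.1 hij).2.2
  rw [coeff_theta, coeff_theta, ← this]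
  push_cast
  ring

theorem theta_C (c : K) : theta (HahnSeries.C c) = 0 := by
  ext k
  rw [coeff_theta]
  by_cases hk : k = 0
  · simp [hk]
  · simp [HahnSeries.C_apply, HahnSeries.coeff_single_of_ne hk]

theorem theta_pow_succ (f : LaurentSeries K) (n : ℕ) :
    theta (f ^ (n + 1)) = (n + 1) * f ^ n * theta f := by
  induction n with
  | zero => simp
  | succ n ih => rw [pow_succ, theta_mul, ih]; push_cast; ring

theorem algebraMap_eq_C : algebraMap K (LaurentSeries K) = HahnSeries.C := by
  ext1 c
  exact HahnSeries.ofPowerSeries_C c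

theorem theta_aeval (F : K[X]) (f : LaurentSeries K) :
    theta (Polynomial.aeval f F) = Polynomial.aeval f (Polynomial.derivative F) * theta f := by
  induction F using Polynomial.induction_on with
  | C a => rw [Polynomial.aeval_C, algebraMap_eq_C, theta_C]; simp
  | add F G hF hG => simp [hF, hG, add_mul]
  | monomial n a _ =>
    have : Polynomial.aeval f (Polynomial.C a * Polynomial.X ^ (n + 1)) =
        HahnSeries.C a * f ^ (n + 1) := by
      rw [map_mul, Polynomial.aeval_C, algebraMap_eq_C, map_pow, Polynomial.aeval_X]
    rw [this, theta_mul, theta_C, theta_pow_succ]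
    simp only [Polynomial.derivative_C_mul, Polynomial.derivative_X_pow, map_mul, map_pow,
      Polynomial.aeval_C, Polynomial.aeval_X, algebraMap_eq_C, map_natCast]
    push_cast
    ring

/-- The automorphism `t ↦ -t` of the field of Laurent series. -/
def reflect : LaurentSeries K →+* LaurentSeries K where
  __ := scale (fun k ↦ ((k.negOnePow : ℤ) : K))
  map_one' := by
    ext k
    by_cases hk : k = 0
    · subst hk; simp
    · simp [HahnSeries.coeff_one, hk]
  map_mul' f g := by
    ext k
    simp only [ZeroHom.toFun_eq_coe, AddMonoidHom.toZeroHom_coe, coeff_scale]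
    rw [HahnSeries.coeff_mul, coeff_mul_of_support_subset f.isPWO_support g.isPWO_support
      (support_scale _ _) (support_scale _ _), Finset.mul_sum]
    refine Finset.sum_congr rfl fun ij hij ↦ ?_
    have : ij.1 + ij.2 = k := (Finset.mem_antidiagonal.1 hij).2.2
    rw [coeff_scale, coeff_scale, ← this, Int.negOnePow_add]
    push_cast
    ring

theorem coeff_reflect (f : LaurentSeries K) (k : ℤ) :
    (reflect f).coeff k = (k.negOnePow : ℤ) * f.coeff k := rfl

theorem reflect_C (c : K) : reflect (HahnSeries.C c) = HahnSeries.C c := by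
  ext k
  rw [coeff_reflect]
  by_cases hk : k = 0
  · simp [hk]
  · simp [HahnSeries.C_apply, HahnSeries.coeff_single_of_ne hk]

theorem reflect_aeval (F : K[X]) (f : LaurentSeries K) :
    reflect (Polynomial.aeval f F) = Polynomial.aeval (reflect f) F := by
  have h : (reflect (K := K)).comp HahnSeries.C = HahnSeries.C := RingHom.ext reflect_C
  simp only [Polynomial.aeval_def, algebraMap_eq_C]
  rw [Polynomial.hom_eval₂, h]

theorem coeff_eq_zero_of_reflect_eq [CharZero K] {f : LaurentSeries K} (hf : reflect f = f) {k : ℤ}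
    (hk : Odd k) : f.coeff k = 0 := by
  have h := congrArg (fun g ↦ HahnSeries.coeff g k) hf
  simp only [coeff_reflect, Int.negOnePow_odd k hk] at h
  refine self_eq_neg.1 ?_
  simpa using h.symm

variable {p : ℕ} {q : NNReal} {N : ℤ} {f : LaurentSeries K} {r : ℝ}

theorem Bdd.theta [IsUltrametricDist K] (hf : Bdd r f) : Bdd r (theta f) := fun k ↦ by
  rw [coeff_theta, norm_mul]
  exact (mul_le_of_le_one_left (norm_nonneg _) (IsUltrametricDist.norm_intCast_le_one K k)).trans
    (hf k)

theorem Filt.theta [IsUltrametricDist K] (hf : Filt p q N f) : Filt p q N (theta f) := fun k ↦ by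
  obtain ⟨i, h1, h2⟩ := hf k
  refine ⟨i, h1, ?_⟩
  rw [coeff_theta, nnnorm_mul]
  exact (mul_le_of_le_one_left zero_le (IsUltrametricDist.nnnorm_intCast_le_one K k)).trans h2

end Operators

/-! ### Power series and polynomials with integral coefficients -/

section IntegralSeries

variable {K : Type*} [NormedField K] {p : ℕ} {q : ℝ≥0} {N M : ℤ}

theorem coeff_toL_natCast (x : K⟦X⟧) (n : ℕ) : (toL x).coeff n = PowerSeries.coeff n x :=
  LaurentSeries.coeff_coe_powerSeries x n

theorem coeff_toL_of_neg (x : K⟦X⟧) {k : ℤ} (hk : k < 0) : (toL x).coeff k = 0 := by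
  rw [toL, PowerSeries.coeff_coe, if_pos hk]

theorem toL_X : toL (PowerSeries.X : K⟦X⟧) = HahnSeries.single 1 1 := HahnSeries.ofPowerSeries_X

theorem toL_mul (x y : K⟦X⟧) : toL (x * y) = toL x * toL y := map_mul _ _ _
theorem toL_sub (x y : K⟦X⟧) : toL (x - y) = toL x - toL y := map_sub _ _ _
theorem toL_pow (x : K⟦X⟧) (n : ℕ) : toL (x ^ n) = toL x ^ n := map_pow _ _ _
theorem toL_C (c : K) : toL (PowerSeries.C c) = HahnSeries.C c := HahnSeries.ofPowerSeries_C c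

theorem toL_inv {x : K⟦X⟧} (hx : PowerSeries.constantCoeff x ≠ 0) : toL x⁻¹ = (toL x)⁻¹ := by
  refine eq_inv_of_mul_eq_one_left ?_
  rw [← toL_mul, PowerSeries.inv_mul_cancel _ hx]
  exact map_one _

theorem aeval_toL (x : K⟦X⟧) (F : K[X]) :
    Polynomial.aeval (toL x) F = toL (Polynomial.aeval x F) := by
  have h : (HahnSeries.ofPowerSeries ℤ K).comp (algebraMap K K⟦X⟧) = HahnSeries.C :=
    RingHom.ext fun c ↦ HahnSeries.ofPowerSeries_C c
  rw [Polynomial.aeval_def, Polynomial.aeval_def, algebraMap_eq_C, toL, toL, Polynomial.hom_eval₂, h]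

theorem constantCoeff_aeval (x : K⟦X⟧) (F : K[X]) :
    PowerSeries.constantCoeff (Polynomial.aeval x F) = F.eval (PowerSeries.constantCoeff x) := by
  have h : (PowerSeries.constantCoeff (R := K)).comp (algebraMap K K⟦X⟧) = RingHom.id K :=
    RingHom.ext fun c ↦ PowerSeries.constantCoeff_C c
  rw [Polynomial.aeval_def, Polynomial.hom_eval₂, h]
  rfl

theorem theta_toL (x : K⟦X⟧) :
    theta (toL x) = HahnSeries.single 1 1 * toL (PowerSeries.derivative K x) := by
  ext k
  rw [coeff_theta, HahnSeries.coeff_single_mul, one_mul]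
  rcases lt_trichotomy k 0 with hk | rfl | hk
  · rw [coeff_toL_of_neg _ hk, coeff_toL_of_neg _ (by omega), mul_zero]
  · rw [coeff_toL_of_neg _ (show (0 : ℤ) - 1 < 0 by norm_num)]; simp
  · obtain ⟨n, rfl⟩ : ∃ n : ℕ, k = (n + 1 : ℕ) := ⟨k.toNat - 1, by omega⟩
    rw [coeff_toL_natCast, show ((n + 1 : ℕ) : ℤ) - 1 = n by simp, coeff_toL_natCast,
      PowerSeries.coeff_derivative]
    push_cast
    ring

theorem filt_toL [Fact p.Prime] {x : K⟦X⟧} (hx : ∀ n, ‖PowerSeries.coeff n x‖ ≤ 1)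
    (h0 : ∀ n : ℕ, (n : ℤ) < N → PowerSeries.coeff n x = 0) : Filt p q N (toL x) := by
  refine filt_of_norm_le_one (fun k ↦ ?_) fun k hk ↦ ?_
  all_goals
    rcases lt_or_ge k 0 with h | h
    · simp [coeff_toL_of_neg _ h]
    · lift k to ℕ using h
      rw [coeff_toL_natCast]
      first | exact hx k | exact h0 k hk

theorem norm_coeff_le_one_of_filt (x : K⟦X⟧) (hx : Filt p 0 0 (toL x)) (n : ℕ) :
    ‖PowerSeries.coeff n x‖ ≤ 1 := by
  rw [← coeff_toL_natCast]; exact hx.norm_coeff_le_one zero_le _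

variable [IsUltrametricDist K]

/-- The recursion for the coefficients of the inverse divides only by the constant coefficient, a
unit. -/
theorem norm_coeff_inv_le_one {x : K⟦X⟧} (hx : ∀ n, ‖PowerSeries.coeff n x‖ ≤ 1)
    (h0 : ‖PowerSeries.constantCoeff x‖ = 1) (n : ℕ) : ‖PowerSeries.coeff n x⁻¹‖ ≤ 1 := by
  induction n using Nat.strong_induction_on with
  | _ n ih =>
    rw [PowerSeries.coeff_inv]
    split_ifs
    · simp [h0]
    · rw [norm_mul, norm_neg, norm_inv, h0, inv_one, one_mul]
      refine IsUltrametricDist.norm_sum_le_of_forall_le_of_nonneg zero_le_one fun ij _ ↦ ?_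
      split_ifs with h
      · rw [norm_mul]; exact mul_le_one₀ (hx _) (norm_nonneg _) (ih _ h)
      · simp

theorem filt_inv_toL [Fact p.Prime] {x : K⟦X⟧} (hx : ∀ n, ‖PowerSeries.coeff n x‖ ≤ 1)
    (h0 : ‖PowerSeries.constantCoeff x‖ = 1) : Filt p q 0 (toL x)⁻¹ := by
  rw [← toL_inv (by intro h; simp [h] at h0)]
  exact filt_toL (norm_coeff_inv_le_one hx h0) fun n hn ↦ by omega

section Polynomials

variable {R : Type*} [CommRing R] {ι : R →+* K}

theorem norm_eval_le_one (hι : ∀ r, ‖ι r‖ ≤ 1) (F : R[X]) {z : K} (hz : ‖z‖ ≤ 1) :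
    ‖(F.map ι).eval z‖ ≤ 1 := by
  rw [Polynomial.eval_eq_sum_range]
  refine IsUltrametricDist.norm_sum_le_of_forall_le_of_nonneg zero_le_one fun i _ ↦ ?_
  rw [norm_mul, norm_pow, Polynomial.coeff_map]
  exact mul_le_one₀ (hι _) (by positivity) (pow_le_one₀ (norm_nonneg _) hz)

theorem norm_eval_sub_le (hι : ∀ r, ‖ι r‖ ≤ 1) (F : R[X]) {z w : K} (hz : ‖z‖ ≤ 1) (hw : ‖w‖ ≤ 1) :
    ‖(F.map ι).eval z - (F.map ι).eval w‖ ≤ ‖z - w‖ := by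
  induction F using Polynomial.induction_on' with
  | add F G hF hG =>
    simp only [Polynomial.map_add, Polynomial.eval_add, add_sub_add_comm]
    exact (IsUltrametricDist.norm_add_le_max _ _).trans (max_le hF hG)
  | monomial n a =>
    simp only [Polynomial.map_monomial, Polynomial.eval_monomial, ← mul_sub, norm_mul]
    refine (mul_le_of_le_one_left (norm_nonneg _) (hι a)).trans ?_
    induction n with
    | zero => simp
    | succ n ih =>
      have : z ^ (n + 1) - w ^ (n + 1) = (z ^ n - w ^ n) * z + w ^ n * (z - w) := by ring
      rw [this]
      refine (IsUltrametricDist.norm_add_le_max _ _).trans (max_le ?_ ?_)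
      · rw [norm_mul]; exact (mul_le_of_le_one_right (norm_nonneg _) hz).trans ih
      · rw [norm_mul, norm_pow]
        exact mul_le_of_le_one_left (norm_nonneg _) (pow_le_one₀ (norm_nonneg _) hw)

variable [Fact p.Prime]

theorem filt_aeval (hι : ∀ r, ‖ι r‖ ≤ 1) (F : R[X]) {z : LaurentSeries K} (hz : Filt p q 0 z) :
    Filt p q 0 (Polynomial.aeval z (F.map ι)) := by
  rw [Polynomial.aeval_eq_sum_range]
  refine Filt.sum fun i _ ↦ ?_
  rw [Algebra.smul_def, algebraMap_eq_C, Polynomial.coeff_map]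
  simpa using (filt_C (hι _)).mul (hz.pow i)

theorem Filt.pow_sub_pow {z w : LaurentSeries K} (hz : Filt p q 0 z) (hw : Filt p q 0 w)
    (h : Filt p q M (z - w)) (n : ℕ) : Filt p q M (z ^ n - w ^ n) := by
  induction n with
  | zero => simpa using Filt.zero
  | succ n ih =>
    have : z ^ (n + 1) - w ^ (n + 1) = (z ^ n - w ^ n) * z + w ^ n * (z - w) := by ring
    rw [this]
    exact Filt.add (by simpa using ih.mul hz) (by simpa using (hw.pow n).mul h)

theorem filt_aeval_sub (hι : ∀ r, ‖ι r‖ ≤ 1) (F : R[X]) {z w : LaurentSeries K}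
    (hz : Filt p q 0 z) (hw : Filt p q 0 w) (h : Filt p q M (z - w)) :
    Filt p q M (Polynomial.aeval z (F.map ι) - Polynomial.aeval w (F.map ι)) := by
  rw [Polynomial.aeval_eq_sum_range, Polynomial.aeval_eq_sum_range, ← Finset.sum_sub_distrib]
  refine Filt.sum fun i _ ↦ ?_
  rw [Algebra.smul_def, Algebra.smul_def, ← mul_sub, algebraMap_eq_C, Polynomial.coeff_map]
  simpa using (filt_C (hι _)).mul (hz.pow_sub_pow hw h i)

theorem norm_coeff_aeval_le_one (hι : ∀ r, ‖ι r‖ ≤ 1) (F : R[X]) {x : K⟦X⟧}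
    (hx : ∀ n, ‖PowerSeries.coeff n x‖ ≤ 1) (n : ℕ) :
    ‖PowerSeries.coeff n (Polynomial.aeval x (F.map ι))‖ ≤ 1 := by
  refine norm_coeff_le_one_of_filt (p := 2) _ ?_ n
  rw [← aeval_toL]
  exact filt_aeval hι F (filt_toL hx fun n hn ↦ by omega)

theorem filt_inv_aeval (hι : ∀ r, ‖ι r‖ ≤ 1) (F : R[X]) {x : K⟦X⟧}
    (hx : ∀ n, ‖PowerSeries.coeff n x‖ ≤ 1)
    (h : ‖(F.map ι).eval (PowerSeries.constantCoeff x)‖ = 1) :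
    Filt p q 0 (Polynomial.aeval (toL x) (F.map ι))⁻¹ := by
  rw [aeval_toL]
  exact filt_inv_toL (norm_coeff_aeval_le_one hι F hx) (by rwa [constantCoeff_aeval])

end Polynomials

end IntegralSeries

theorem norm_sub_le_max_of_ultrametric {K : Type*} [NormedField K] [IsUltrametricDist K] (x y : K) :
    ‖x - y‖ ≤ max ‖x‖ ‖y‖ := by
  simpa [sub_eq_add_neg] using IsUltrametricDist.norm_add_le_max x (-y)

/-! ### Reduction modulo `p` and residue discs -/

section Reduction

variable {p : ℕ} [Fact p.Prime]

theorem dvd_of_toZMod_eq_zero {z : ℤ_[p]} (h : PadicInt.toZMod z = 0) : (p : ℤ_[p]) ∣ z := by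
  have : z ∈ RingHom.ker (PadicInt.toZMod (p := p)) := h
  rw [PadicInt.ker_toZMod, PadicInt.maximalIdeal_eq_span_p] at this
  exact Ideal.mem_span_singleton.1 this

/-- Over the prime field `f(x^p) = f(x)^p`. This factor `p` is what pays for the poles of `φ^*ω`. -/
theorem exists_expand_sub_pow (f : ℤ_[p][X]) :
    ∃ E : ℤ_[p][X], Polynomial.expand ℤ_[p] p f - f ^ p = Polynomial.C (p : ℤ_[p]) * E := by
  refine (Polynomial.C_dvd_iff_dvd_coeff _ _).2 fun i ↦ dvd_of_toZMod_eq_zero ?_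
  rw [← Polynomial.coeff_map, Polynomial.map_sub, Polynomial.map_pow, Polynomial.map_expand,
    ZMod.expand_card, sub_self, Polynomial.coeff_zero]

variable (K : Type*) [NormedField K] [NormedAlgebra ℚ_[p] K]

@[simp]
theorem norm_padicIntTo (z : ℤ_[p]) : ‖padicIntTo p K z‖ = ‖z‖ :=
  norm_algebraMap' K (z : ℚ_[p])

theorem norm_padicIntTo_le_one (z : ℤ_[p]) : ‖padicIntTo p K z‖ ≤ 1 := by
  rw [norm_padicIntTo]; exact z.norm_le_one

theorem norm_natCast (n : ℕ) : ‖(n : K)‖ = ‖(n : ℚ_[p])‖ := by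
  rw [← norm_algebraMap' K (n : ℚ_[p]), map_natCast]

theorem norm_prime : ‖(p : K)‖ = (p : ℝ)⁻¹ := by
  rw [norm_natCast (p := p) K, Padic.norm_p]

theorem norm_natCast_eq_pow {n : ℕ} (hn : n ≠ 0) :
    ‖(n : K)‖ = ((p : ℝ)⁻¹) ^ padicValNat p n := by
  rw [norm_natCast (p := p) K, ← Rat.cast_natCast n, Padic.eq_padicNorm,
    padicNorm.eq_zpow_of_nonzero (by exact_mod_cast hn), padicValRat.of_nat]
  rw [zpow_neg, zpow_natCast, inv_pow]
  push_cast
  rfl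

theorem inv_le_norm_natCast (p : ℕ) [Fact p.Prime] (K : Type*) [NormedField K]
    [NormedAlgebra ℚ_[p] K] {n : ℕ} (hn : n ≠ 0) : (n : ℝ)⁻¹ ≤ ‖(n : K)‖ := by
  have hp := (Fact.out : p.Prime)
  rw [norm_natCast_eq_pow (p := p) K hn, inv_pow]
  have : p ^ padicValNat p n ≤ n := Nat.le_of_dvd (Nat.pos_of_ne_zero hn) pow_padicValNat_dvd
  have h2 : 0 < p ^ padicValNat p n := pow_pos hp.pos _
  refine inv_anti₀ (by exact_mod_cast h2) (by exact_mod_cast this)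

theorem le_norm_natCast {n v : ℕ} (hn : n ≠ 0) (h : n < p ^ (v + 1)) :
    ((p : ℝ)⁻¹) ^ v ≤ ‖(n : K)‖ := by
  have hp := (Fact.out : p.Prime)
  rw [norm_natCast_eq_pow (p := p) K hn]
  have h3 : p ^ padicValNat p n ≤ n := Nat.le_of_dvd (Nat.pos_of_ne_zero hn) pow_padicValNat_dvd
  have := (Nat.pow_lt_pow_iff_right hp.one_lt).1 (h3.trans_lt h)
  refine pow_le_pow_of_le_one (by positivity) (inv_le_one_of_one_le₀ ?_) (by omega)
  exact_mod_cast hp.one_le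

variable {K}

theorem aeval_pow_sub {f E : ℤ_[p][X]}
    (hE : Polynomial.expand ℤ_[p] p f - f ^ p = Polynomial.C (p : ℤ_[p]) * E)
    {A : Type*} [CommRing A] [Algebra K A] (z : A) :
    Polynomial.aeval (z ^ p) (f.map (padicIntTo p K)) -
      Polynomial.aeval z (f.map (padicIntTo p K)) ^ p =
      p * Polynomial.aeval z (E.map (padicIntTo p K)) := by
  have h := congrArg (fun P ↦ Polynomial.aeval z (P.map (padicIntTo p K))) hE
  simpa [Polynomial.map_expand] using h

variable [IsUltrametricDist K]

theorem norm_eval_lt_one {G : ℤ_[p][X]} (hG : G.map (PadicInt.toZMod (p := p)) = 0) {z : K}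
    (hz : ‖z‖ ≤ 1) : ‖(G.map (padicIntTo p K)).eval z‖ < 1 := by
  obtain ⟨H, rfl⟩ : Polynomial.C (p : ℤ_[p]) ∣ G :=
    (Polynomial.C_dvd_iff_dvd_coeff _ _).2 fun i ↦ dvd_of_toZMod_eq_zero (by
      rw [← Polynomial.coeff_map, hG, Polynomial.coeff_zero])
  rw [Polynomial.map_mul, Polynomial.eval_mul, norm_mul, Polynomial.map_C, Polynomial.eval_C,
    norm_padicIntTo]
  have h1 := norm_eval_le_one (norm_padicIntTo_le_one (p := p) K) H hz
  have h2 : ‖(p : ℤ_[p])‖ < 1 := by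
    rw [PadicInt.norm_p]; exact inv_lt_one_of_one_lt₀ (by exact_mod_cast (Fact.out : p.Prime).one_lt)
  exact (mul_le_of_le_one_right (norm_nonneg _) h1).trans_lt h2

/-- Separability lifts to `u f + v f' ≡ 1` modulo `p`; if `f(z)` and `f'(z)` were both small, `1`
would be small. -/
theorem norm_eval_derivative {f : ℤ_[p][X]} (hgood : (f.map (PadicInt.toZMod (p := p))).Separable)
    {z : K} (hz : ‖z‖ ≤ 1) (hfz : ‖(f.map (padicIntTo p K)).eval z‖ < 1) :
    ‖(f.derivative.map (padicIntTo p K)).eval z‖ = 1 := by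
  obtain ⟨U, V, h⟩ := hgood
  have hs := Polynomial.map_surjective _ (ZMod.ringHom_surjective (PadicInt.toZMod (p := p)))
  obtain ⟨u, rfl⟩ := hs U
  obtain ⟨v, rfl⟩ := hs V
  rw [Polynomial.derivative_map, ← Polynomial.map_mul, ← Polynomial.map_mul, ← Polynomial.map_add]
    at h
  have h1 := norm_eval_lt_one (G := u * f + v * f.derivative - 1) (by simp [Polynomial.map_sub, h])
    hz
  simp only [Polynomial.map_sub, Polynomial.map_add, Polynomial.map_mul, Polynomial.map_one,
    Polynomial.eval_sub, Polynomial.eval_add, Polynomial.eval_mul, Polynomial.eval_one] at h1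
  have hle := norm_eval_le_one (norm_padicIntTo_le_one (p := p) K)
  refine le_antisymm (hle f.derivative hz) (not_lt.1 fun hlt ↦ ?_)
  set A := (f.map (padicIntTo p K)).eval z
  set B := (f.derivative.map (padicIntTo p K)).eval z
  have hA : ‖(u.map (padicIntTo p K)).eval z * A‖ < 1 := by
    rw [norm_mul]; exact (mul_le_of_le_one_left (norm_nonneg _) (hle u hz)).trans_lt hfz
  have hB : ‖(v.map (padicIntTo p K)).eval z * B‖ < 1 := by
    rw [norm_mul]; exact (mul_le_of_le_one_left (norm_nonneg _) (hle v hz)).trans_lt hlt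
  have h2 := (IsUltrametricDist.norm_add_le_max _ _).trans_lt (max_lt hA hB)
  have h3 := (norm_sub_le_max_of_ultrametric _ _).trans_lt (max_lt h2 h1)
  rw [sub_sub_cancel, norm_one] at h3
  exact lt_irrefl _ h3

/-- Outside the unit disc the leading term of a monic integral polynomial strictly dominates the
others. -/
theorem norm_le_one_of_root {f : ℤ_[p][X]} (hf : f.Monic) {a : K}
    (ha : (f.map (padicIntTo p K)).eval a = 0) : ‖a‖ ≤ 1 := by
  by_contra! hlt
  have hm := hf.map (padicIntTo p K)
  rw [hm.as_sum] at ha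
  simp only [Polynomial.eval_add, Polynomial.eval_pow, Polynomial.eval_X,
    Polynomial.eval_finsetSum, Polynomial.eval_mul, Polynomial.eval_C] at ha
  set d := (f.map (padicIntTo p K)).natDegree
  have h1 : ‖∑ i ∈ Finset.range d, (f.map (padicIntTo p K)).coeff i * a ^ i‖ < ‖a‖ ^ d := by
    rcases Nat.eq_zero_or_pos d with hd | hd
    · simp [hd]
    · refine (IsUltrametricDist.norm_sum_le_of_forall_le_of_nonneg (C := ‖a‖ ^ (d - 1))
        (by positivity) fun i hi ↦ ?_).trans_lt (pow_lt_pow_right₀ hlt (by omega))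
      rw [norm_mul, Polynomial.coeff_map, norm_pow]
      refine (mul_le_of_le_one_left (by positivity) (norm_padicIntTo_le_one K _)).trans
        (pow_le_pow_right₀ hlt.le ?_)
      have := Finset.mem_range.1 hi
      omega
  rw [eq_neg_of_add_eq_zero_right ha, norm_neg, norm_pow] at h1
  exact lt_irrefl _ h1

/-- If `z` were congruent to `xP`, then `f(z)` would be congruent to the unit `yP²`. This keeps the
pole of the differential off the Weierstrass disc. -/
theorem norm_sub_eq_one {f : ℤ_[p][X]} {xP yP : ℤ_[p]} (hP : yP ^ 2 = f.eval xP)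
    (hyP : IsUnit yP) {z : K} (hz : ‖z‖ ≤ 1) (hfz : ‖(f.map (padicIntTo p K)).eval z‖ < 1) :
    ‖z - padicIntTo p K xP‖ = 1 := by
  have hx := norm_padicIntTo_le_one K xP
  refine le_antisymm ((norm_sub_le_max_of_ultrametric _ _).trans (max_le hz hx))
    (not_lt.1 fun hlt ↦ ?_)
  have h1 := (norm_eval_sub_le (norm_padicIntTo_le_one (p := p) K) f hz hx).trans_lt hlt
  have h2 := (norm_sub_le_max_of_ultrametric _ _).trans_lt (max_lt hfz h1)
  rw [sub_sub_cancel, Polynomial.eval_map_apply, ← hP, norm_padicIntTo, norm_pow,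
    PadicInt.isUnit_iff.1 hyP, one_pow] at h2
  exact lt_irrefl _ h2

end Reduction

/-! ### The binomial series of exponent `-1/2` over `ℤ_p` -/

section Binomial

variable {p : ℕ} [Fact p.Prime]

theorem exists_neg_half (hp : p ≠ 2) : ∃ h : ℤ_[p], 2 * h = -1 := by
  have : IsUnit (2 : ℤ_[p]) := by
    rw [PadicInt.isUnit_iff, show (2 : ℤ_[p]) = ((2 : ℕ) : ℤ_[p]) by simp, PadicInt.norm_natCast_eq_one_iff]
    exact (Nat.coprime_primes Fact.out Nat.prime_two).2 hp
  obtain ⟨u, hu⟩ := this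
  exact ⟨-↑u⁻¹, by rw [← hu]; simp⟩

/-- Since `-1/2` lies in the binomial ring `ℤ_p`, its binomial coefficients are `p`-integral. -/
theorem ratCast_choose (K : Type*) [NormedField K] [NormedAlgebra ℚ_[p] K] {h : ℤ_[p]}
    (hh : 2 * h = -1) (i : ℕ) :
    ((Ring.choose (-1 / 2 : ℚ) i : ℚ) : K) = padicIntTo p K (Ring.choose h i) := by
  have h1 : ((-1 / 2 : ℚ) : ℚ_[p]) = algebraMap ℤ_[p] ℚ_[p] h := by
    have := congrArg (algebraMap ℤ_[p] ℚ_[p]) hh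
    simp only [map_mul, map_neg, map_one, map_ofNat] at this
    push_cast
    linear_combination -this / 2
  have h2 := Ring.map_choose (Rat.castHom ℚ_[p]) (-1 / 2 : ℚ) i
  have h3 := Ring.map_choose (algebraMap ℤ_[p] ℚ_[p]) h i
  rw [Rat.coe_castHom, h1] at h2
  rw [padicIntTo, RingHom.comp_apply, h3, ← h2, map_ratCast]

/-- The full series is an exact inverse square root of `1 + X`, as `h + h + 1 = 0`. The truncated
polynomial, unlike the series, can be evaluated at any Laurent series. -/
theorem exists_truncated_binomial {h : ℤ_[p]} (hh : 2 * h = -1) (L : ℕ) :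
    ∃ R : ℤ_[p][X], (∑ i ∈ Finset.range L, Polynomial.C (Ring.choose h i) * Polynomial.X ^ i) ^ 2 *
      (1 + Polynomial.X) = 1 + Polynomial.X ^ L * R := by
  set b : ℤ_[p]⟦X⟧ := PowerSeries.binomialSeries ℤ_[p] h
  have hb : b ^ 2 * (1 + PowerSeries.X) = 1 := by
    have h1 : PowerSeries.binomialSeries ℤ_[p] ((1 : ℕ) : ℤ_[p]) = (1 + PowerSeries.X) ^ 1 :=
      PowerSeries.binomialSeries_nat 1
    rw [pow_one] at h1
    rw [pow_two, ← h1, ← PowerSeries.binomialSeries_add, ← PowerSeries.binomialSeries_add,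
      show h + h + ((1 : ℕ) : ℤ_[p]) = ((0 : ℕ) : ℤ_[p]) by push_cast; linear_combination hh,
      PowerSeries.binomialSeries_nat, pow_zero]
  set B : ℤ_[p][X] := ∑ i ∈ Finset.range L, Polynomial.C (Ring.choose h i) * Polynomial.X ^ i
  have hB : (PowerSeries.X : ℤ_[p]⟦X⟧) ^ L ∣ (B : ℤ_[p]⟦X⟧) - b := by
    rw [PowerSeries.X_pow_dvd_iff]
    intro m hm
    simp [B, b, Polynomial.finsetSum_coeff, hm]
  have h2 : (PowerSeries.X : ℤ_[p]⟦X⟧) ^ L ∣ ((B ^ 2 * (1 + Polynomial.X) - 1 : ℤ_[p][X]) : ℤ_[p]⟦X⟧) := by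
    have : ((B ^ 2 * (1 + Polynomial.X) - 1 : ℤ_[p][X]) : ℤ_[p]⟦X⟧) =
        ((B : ℤ_[p]⟦X⟧) - b) * (((B : ℤ_[p]⟦X⟧) + b) * (1 + PowerSeries.X)) := by
      push_cast
      linear_combination hb
    rw [this]
    exact hB.mul_right _
  obtain ⟨R, hR⟩ : (Polynomial.X : ℤ_[p][X]) ^ L ∣ B ^ 2 * (1 + Polynomial.X) - 1 := by
    rw [Polynomial.X_pow_dvd_iff]
    intro m hm
    rw [← Polynomial.coeff_coe]
    exact PowerSeries.X_pow_dvd_iff.1 h2 m hm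
  exact ⟨R, by rw [← hR]; ring⟩

end Binomial

/-! ### Hensel's lemma in the `X`-adic topology -/

section Adic

variable {R : Type*} [CommRing R]

instance isAdicComplete_powerSeries :
    IsAdicComplete (Ideal.span {(PowerSeries.X : R⟦X⟧)}) R⟦X⟧ where
  haus' x hx := by
    ext n
    have h := hx (n + 1)
    rw [SModEq.zero, smul_eq_mul, Ideal.mul_top, Ideal.span_singleton_pow,
      Ideal.mem_span_singleton, PowerSeries.X_pow_dvd_iff] at h
    simpa using h n (Nat.lt_succ_self n)
  prec' x hx := by
    simp only [smul_eq_mul, Ideal.mul_top, Ideal.span_singleton_pow, SModEq.sub_mem,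
      Ideal.mem_span_singleton, PowerSeries.X_pow_dvd_iff] at hx ⊢
    refine ⟨PowerSeries.mk fun n ↦ PowerSeries.coeff n (x (n + 1)), fun n m hm ↦ ?_⟩
    have := hx (m := m + 1) (n := n) hm m (Nat.lt_succ_self m)
    simp only [map_sub, PowerSeries.coeff_mk] at this ⊢
    rw [← neg_sub, this, neg_zero]

/-- Hensel's lemma for power series. -/
theorem exists_powerSeries_root {F : R[X]} (hF : F.Monic) {a : R} (ha : F.eval a = 0)
    (hF' : IsUnit (F.derivative.eval a)) {s : R⟦X⟧} (hs : PowerSeries.constantCoeff s = 0)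
    (hdeg : 1 ≤ F.natDegree) :
    ∃ x : R⟦X⟧, PowerSeries.constantCoeff x = a ∧ Polynomial.aeval x F = s := by
  nontriviality R
  have heval : ∀ (G : R[X]), (G.map (PowerSeries.C (R := R))).eval (PowerSeries.C a) =
      PowerSeries.C (G.eval a) := fun G ↦ by
    rw [Polynomial.eval_map, Polynomial.eval₂_at_apply]
  have hm : (F.map (PowerSeries.C (R := R)) - Polynomial.C s).Monic := by
    refine (hF.map _).sub_of_left (Polynomial.degree_C_le.trans_lt ?_)
    rw [hF.degree_map, Polynomial.degree_eq_natDegree hF.ne_zero]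
    exact_mod_cast hdeg
  obtain ⟨x, hx, hxa⟩ := HenselianRing.is_henselian (I := Ideal.span {(PowerSeries.X : R⟦X⟧)}) _ hm
    (PowerSeries.C a) (by
      rw [Polynomial.eval_sub, heval, ha, map_zero, Polynomial.eval_C, zero_sub,
        Ideal.mem_span_singleton, PowerSeries.X_dvd_iff, map_neg, hs, neg_zero])
    (by
      rw [Polynomial.derivative_sub, Polynomial.derivative_C, sub_zero, Polynomial.derivative_map,
        heval]
      exact (hF'.map _).map _)
  refine ⟨x, ?_, ?_⟩
  · rw [Ideal.mem_span_singleton, PowerSeries.X_dvd_iff, map_sub, PowerSeries.constantCoeff_C]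
      at hxa
    exact sub_eq_zero.1 hxa
  · rw [Polynomial.IsRoot, Polynomial.eval_sub, Polynomial.eval_C, Polynomial.eval_map] at hx
    exact sub_eq_zero.1 hx

/-- By Taylor expansion `F(z) - F(x)` is `z - x` times a series with constant term `F'(a)`. -/
theorem powerSeries_root_unique [IsDomain R] {F : R[X]} {a : R} (hF' : F.derivative.eval a ≠ 0)
    {x z : R⟦X⟧} (hx : PowerSeries.constantCoeff x = a) (hz : PowerSeries.constantCoeff z = a)
    (h : Polynomial.aeval x F = Polynomial.aeval z F) : x = z := by
  obtain ⟨k, hk⟩ := Polynomial.binomExpansion (F.map (PowerSeries.C (R := R))) x (z - x)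
  rw [add_sub_cancel] at hk
  have e : ∀ w : R⟦X⟧, (F.map (PowerSeries.C (R := R))).eval w = Polynomial.aeval w F := fun w ↦ by
    rw [Polynomial.eval_map]; rfl
  rw [e, e, h, Polynomial.derivative_map] at hk
  have h0 : (z - x) * ((F.derivative.map (PowerSeries.C (R := R))).eval x + k * (z - x)) = 0 := by
    linear_combination -hk
  rcases mul_eq_zero.1 h0 with h1 | h1
  · exact (sub_eq_zero.1 h1).symm
  · exfalso
    have h2 := congrArg PowerSeries.constantCoeff h1
    have hc : (PowerSeries.constantCoeff (R := R)).comp PowerSeries.C = RingHom.id R :=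
      RingHom.ext fun c ↦ PowerSeries.constantCoeff_C c
    rw [map_add, map_mul, map_sub, hx, hz, sub_self, mul_zero, add_zero, Polynomial.eval_map,
      Polynomial.hom_eval₂, hc, hx, map_zero] at h2
    exact hF' h2

end Adic

/-! ### Hensel's lemma in the ring of integers of `K` -/

section UnitBall

/-- The ring of integers of an ultrametric field. -/
def unitBall (K : Type*) [NormedField K] [IsUltrametricDist K] : Subring K where
  carrier := {x | ‖x‖ ≤ 1}
  mul_mem' {x y} hx hy := by
    simp only [Set.mem_ofPred_eq, norm_mul] at *
    exact mul_le_one₀ hx (norm_nonneg _) hy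
  one_mem' := by simp
  add_mem' {x y} hx hy := (IsUltrametricDist.norm_add_le_max x y).trans (max_le hx hy)
  zero_mem' := by simp
  neg_mem' {x} hx := by simpa using hx

variable {K : Type*} [NormedField K] [IsUltrametricDist K]

theorem mem_unitBall {x : K} : x ∈ unitBall K ↔ ‖x‖ ≤ 1 := Iff.rfl

theorem isUnit_unitBall {x : unitBall K} (hx : ‖(x : K)‖ = 1) : IsUnit x := by
  have h0 : (x : K) ≠ 0 := by intro h; simp [h] at hx
  refine IsUnit.of_mul_eq_one ⟨(x : K)⁻¹, by simp [mem_unitBall, hx]⟩ (Subtype.ext ?_)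
  exact mul_inv_cancel₀ h0

variable {p : ℕ} [Fact p.Prime] [NormedAlgebra ℚ_[p] K]

theorem mem_span_prime_pow {x : unitBall K} {n : ℕ} :
    x ∈ Ideal.span {(p : unitBall K) ^ n} ↔ ‖(x : K)‖ ≤ ((p : ℝ)⁻¹) ^ n := by
  rw [Ideal.mem_span_singleton]
  constructor
  · rintro ⟨y, rfl⟩
    simp only [Subring.coe_mul, Subring.coe_pow, Subring.coe_natCast, norm_mul, norm_pow,
      norm_prime (p := p) K]
    exact mul_le_of_le_one_right (by positivity) y.2
  · intro h
    have hp : (0 : ℝ) < p := by exact_mod_cast (Fact.out : p.Prime).pos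
    have hpK : ‖(p : K)‖ = (p : ℝ)⁻¹ := norm_prime K
    have h0 : (p : K) ≠ 0 := by
      intro h0
      rw [h0, norm_zero] at hpK
      exact (inv_pos.2 hp).ne hpK
    refine ⟨⟨x / (p : K) ^ n, ?_⟩, Subtype.ext ?_⟩
    · rw [mem_unitBall, norm_div, norm_pow, hpK]
      exact div_le_one_of_le₀ h (by positivity)
    · exact (mul_div_cancel₀ _ (pow_ne_zero _ h0)).symm

/-- The ideal is `(p)` and not the maximal ideal because the valuation of `K` need not be discrete;
powers of `(p)` are closed balls, so completeness of `K` suffices. -/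
theorem isAdicComplete_unitBall [CompleteSpace K] :
    IsAdicComplete (Ideal.span {(p : unitBall K)}) (unitBall K) := by
  have hp : 1 < (p : ℝ) := by exact_mod_cast (Fact.out : p.Prime).one_lt
  have hlim : Filter.Tendsto (fun n : ℕ ↦ ((p : ℝ)⁻¹) ^ n) Filter.atTop (nhds 0) :=
    tendsto_pow_atTop_nhds_zero_of_lt_one (by positivity) (inv_lt_one_of_one_lt₀ hp)
  exact
  { haus' := fun x hx ↦ by
      simp only [SModEq.zero, smul_eq_mul, Ideal.mul_top, Ideal.span_singleton_pow,
        mem_span_prime_pow] at hx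
      exact Subtype.ext (norm_le_zero_iff.1 (ge_of_tendsto' hlim hx))
    prec' := fun x hx ↦ by
      simp only [smul_eq_mul, Ideal.mul_top, Ideal.span_singleton_pow, SModEq.sub_mem,
        mem_span_prime_pow, AddSubgroupClass.coe_sub] at hx ⊢
      have hd : ∀ {m n : ℕ}, m ≤ n → dist (x m : K) (x n) ≤ ((p : ℝ)⁻¹) ^ m := fun h ↦ by
        rw [dist_eq_norm]; exact hx h
      obtain ⟨l, hl⟩ := cauchySeq_tendsto_of_complete
        (cauchySeq_of_le_tendsto_0' (fun n ↦ ((p : ℝ)⁻¹) ^ n) (fun m n ↦ hd) hlim)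
      have hdl : ∀ n, ‖(x n : K) - l‖ ≤ ((p : ℝ)⁻¹) ^ n := fun n ↦ by
        refine le_of_tendsto ((tendsto_const_nhds.sub hl).norm)
          (Filter.eventually_atTop.2 ⟨n, fun m hm ↦ hx hm⟩)
      have hl1 : ‖l‖ ≤ 1 := le_of_tendsto' hl.norm fun n ↦ (x n).2
      exact ⟨⟨l, hl1⟩, hdl⟩ }

/-- Hensel's lemma for the ring of integers of a complete extension of `ℚ_p`. -/
theorem exists_root_of_norm_le [CompleteSpace K] {F : (unitBall K)[X]} (hF : F.Monic)
    {b : unitBall K} (hb : ‖((F.eval b : unitBall K) : K)‖ ≤ (p : ℝ)⁻¹) (hF' : IsUnit (F.derivative.eval b)) :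
    ∃ a : unitBall K, F.eval a = 0 ∧ ‖(a - b : K)‖ ≤ (p : ℝ)⁻¹ := by
  have := isAdicComplete_unitBall (K := K) (p := p)
  have hmem : ∀ x : unitBall K, x ∈ Ideal.span {(p : unitBall K)} ↔ ‖(x : K)‖ ≤ (p : ℝ)⁻¹ :=
    fun x ↦ by simpa using mem_span_prime_pow (p := p) (x := x) (n := 1)
  obtain ⟨a, ha, hab⟩ := HenselianRing.is_henselian (I := Ideal.span {(p : unitBall K)}) F hF b
    ((hmem _).2 hb) (hF'.map _)
  exact ⟨a, ha, (hmem _).1 hab⟩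

end UnitBall

/-! ### Existence, integrality and evenness of the local coordinates -/

section LocalCoordinates

variable {p : ℕ} [Fact p.Prime] {K : Type*} [NormedField K] [NormedAlgebra ℚ_[p] K]
  [IsUltrametricDist K]

/-- The structure map from `ℤ_p` to the ring of integers of an extension of `ℚ_p`. -/
def padicIntToUnitBall (p : ℕ) [Fact p.Prime] (K : Type*) [NormedField K] [NormedAlgebra ℚ_[p] K]
    [IsUltrametricDist K] : ℤ_[p] →+* unitBall K :=
  (padicIntTo p K).codRestrict (unitBall K) (norm_padicIntTo_le_one K)

theorem map_padicIntToUnitBall (F : ℤ_[p][X]) :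
    (F.map (padicIntToUnitBall p K)).map (unitBall K).subtype = F.map (padicIntTo p K) := by
  rw [Polynomial.map_map]; rfl

theorem coe_eval_map_padicIntToUnitBall (F : ℤ_[p][X]) (z : unitBall K) :
    (((F.map (padicIntToUnitBall p K)).eval z : unitBall K) : K) =
      (F.map (padicIntTo p K)).eval (z : K) := by
  rw [← map_padicIntToUnitBall]
  exact (Polynomial.eval₂_at_apply (unitBall K).subtype z).symm.trans (Polynomial.eval_map _ _).symm

variable {f : ℤ_[p][X]} {a : K}

theorem eval_derivative_ne_zero (hf : f.Monic)
    (hgood : (f.map (PadicInt.toZMod (p := p))).Separable)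
    (haf : (f.map (padicIntTo p K)).eval a = 0) :
    (f.map (padicIntTo p K)).derivative.eval a ≠ 0 := by
  have h := norm_eval_derivative hgood (norm_le_one_of_root hf haf) (by simp [haf])
  rw [Polynomial.derivative_map]
  intro h0
  simp [h0] at h

/-- Solving over the ring of integers, where `f'(a)` is a unit, gives integrality of the
coefficients; uniqueness is over `K`. -/
theorem existsUnique_localCoordinates (hf : f.Monic) (hdeg : 1 ≤ f.natDegree)
    (hgood : (f.map (PadicInt.toZMod (p := p))).Separable)
    (haf : (f.map (padicIntTo p K)).eval a = 0) :
    ∃ x : K⟦X⟧, (∀ n, ‖PowerSeries.coeff n x‖ ≤ 1) ∧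
      IsLocalCoordinates (f.map (padicIntTo p K)) a x PowerSeries.X ∧
      ∀ z y : K⟦X⟧, IsLocalCoordinates (f.map (padicIntTo p K)) a z y → z = x := by
  have ha := norm_le_one_of_root hf haf
  set A : unitBall K := ⟨a, ha⟩
  obtain ⟨x, hx, hxF⟩ := exists_powerSeries_root (hf.map (padicIntToUnitBall p K)) (a := A)
    (Subtype.ext (by rw [coe_eval_map_padicIntToUnitBall]; exact haf))
    (isUnit_unitBall (by
      rw [Polynomial.derivative_map, coe_eval_map_padicIntToUnitBall]
      exact norm_eval_derivative hgood ha (by simp [A, haf])))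
    (s := PowerSeries.X ^ 2) (by simp) (by rwa [hf.natDegree_map])
  have h1 : IsLocalCoordinates (f.map (padicIntTo p K)) a (x.map (unitBall K).subtype)
      PowerSeries.X := by
    refine ⟨rfl, ?_, ?_⟩
    · rw [← PowerSeries.coeff_zero_eq_constantCoeff_apply, PowerSeries.coeff_map,
        PowerSeries.coeff_zero_eq_constantCoeff_apply, hx]
      rfl
    · have := congrArg (PowerSeries.map (unitBall K).subtype) hxF
      rw [map_pow, PowerSeries.map_X, Polynomial.aeval_def, Polynomial.hom_eval₂] at this
      rw [← this, ← map_padicIntToUnitBall, Polynomial.aeval_def]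
      simp only [Polynomial.eval₂_map]
      congr 1
      refine RingHom.ext fun r ↦ ?_
      exact PowerSeries.map_C (unitBall K).subtype (padicIntToUnitBall p K r)
  refine ⟨_, fun n ↦ ?_, h1, fun z y hz ↦ ?_⟩
  · rw [PowerSeries.coeff_map]; exact (PowerSeries.coeff n x).2
  · refine powerSeries_root_unique (eval_derivative_ne_zero hf hgood haf) hz.center h1.center ?_
    rw [← hz.curve, ← h1.curve, hz.parameter]

/-- The equation `f(x(t)) = t²` and the centre are invariant under `t ↦ -t`. -/
theorem IsLocalCoordinates.evalNegHom_eq (hf : f.Monic)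
    (hgood : (f.map (PadicInt.toZMod (p := p))).Separable)
    (haf : (f.map (padicIntTo p K)).eval a = 0) {x y : K⟦X⟧}
    (hx : IsLocalCoordinates (f.map (padicIntTo p K)) a x y) : PowerSeries.evalNegHom x = x := by
  refine powerSeries_root_unique (eval_derivative_ne_zero hf hgood haf) (a := a) ?_ hx.center ?_
  · have h := hx.center
    rw [← PowerSeries.coeff_zero_eq_constantCoeff_apply] at h ⊢
    simp [PowerSeries.evalNegHom, PowerSeries.coeff_rescale, h]
  · have h := congrArg PowerSeries.evalNegHom hx.curve
    have hC : (PowerSeries.evalNegHom (A := K)).comp (algebraMap K K⟦X⟧) = algebraMap K K⟦X⟧ := by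
      ext c n
      rcases n with _ | n <;>
      simp [PowerSeries.evalNegHom, PowerSeries.coeff_rescale, PowerSeries.coeff_C]
    rw [Polynomial.aeval_def, Polynomial.hom_eval₂, hC, ← Polynomial.aeval_def] at h
    rw [← h, ← hx.curve, hx.parameter]
    simp

theorem IsLocalCoordinates.coeff_eq_zero_of_odd (hf : f.Monic)
    (hgood : (f.map (PadicInt.toZMod (p := p))).Separable)
    (haf : (f.map (padicIntTo p K)).eval a = 0) {x y : K⟦X⟧}
    (hx : IsLocalCoordinates (f.map (padicIntTo p K)) a x y) {n : ℕ} (hn : Odd n) :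
    PowerSeries.coeff n x = 0 := by
  have : CharZero K := charZero_of_injective_algebraMap (algebraMap ℚ_[p] K).injective
  have h := congrArg (PowerSeries.coeff n) (hx.evalNegHom_eq hf hgood haf)
  rw [PowerSeries.evalNegHom, PowerSeries.coeff_rescale, hn.neg_one_pow, neg_one_mul] at h
  exact self_eq_neg.1 h.symm

end LocalCoordinates

/-! ### The expansions of `ω` and `φ^*ω` written with `t d/dt`, and their parity -/

section Terms

variable {K : Type*} [NormedField K]

/-- The function `yP / (u - xP) + hol(u)` of the coordinate `u`. -/
def Diff.rat (ω : Diff K) (u : LaurentSeries K) : LaurentSeries K :=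
  HahnSeries.C ω.yP * (u - HahnSeries.C ω.xP)⁻¹ + Polynomial.aeval u ω.hol

theorem single_mul_single_neg (n : ℤ) :
    HahnSeries.single n (1 : K) * HahnSeries.single (-n) 1 = 1 := by
  rw [HahnSeries.single_mul_single]; simp

theorem inv_toL_X_pow (n : ℕ) :
    (toL (PowerSeries.X : K⟦X⟧) ^ n)⁻¹ = HahnSeries.single (-(n : ℤ)) 1 := by
  symm
  refine eq_inv_of_mul_eq_one_left ?_
  rw [toL_X, HahnSeries.single_pow, mul_comm, one_pow, nsmul_eq_mul, mul_one]
  exact single_mul_single_neg _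

theorem coeff_single_one_mul (f : LaurentSeries K) (k : ℤ) :
    (HahnSeries.single 1 (1 : K) * f).coeff k = f.coeff (k - 1) := by
  rw [HahnSeries.coeff_single_mul, one_mul]

theorem coeff_single_one_pow_two_mul (f : LaurentSeries K) (k : ℤ) :
    (HahnSeries.single 1 (1 : K) ^ 2 * f).coeff k = f.coeff (k - 2) := by
  rw [pow_two, mul_assoc, coeff_single_one_mul, coeff_single_one_mul]
  congr 1
  ring

/-- The quantity `(F(x ^ p) - F(x) ^ p) / t ^ (2 p)` expanded in the binomial series. -/
def frobeniusError (p : ℕ) (F : K[X]) (z : LaurentSeries K) : LaurentSeries K :=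
  (Polynomial.aeval (z ^ p) F - Polynomial.aeval z F ^ p) * HahnSeries.single (-(2 * p : ℤ)) 1

theorem single_mul_frobeniusTerm (p : ℕ) (F : K[X]) (ω : Diff K) (x : K⟦X⟧) (i : ℕ) :
    HahnSeries.single 1 1 * ω.frobeniusTerm p F x PowerSeries.X i =
      (p : LaurentSeries K) * HahnSeries.single (-(p : ℤ)) 1 *
        HahnSeries.C ((Ring.choose (-1 / 2 : ℚ) i : ℚ) : K) *
        (ω.rat (toL x ^ p) * toL x ^ (p - 1) * frobeniusError p F (toL x) ^ i) * theta (toL x) := by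
  rw [theta_toL, Diff.frobeniusTerm, inv_toL_X_pow, inv_toL_X_pow, Diff.rat, frobeniusError]
  push_cast
  ring

theorem single_mul_expand (ω : Diff K) (x : K⟦X⟧) :
    HahnSeries.single 1 1 ^ 2 * ω.expand x PowerSeries.X = ω.rat (toL x) * theta (toL x) := by
  have h := inv_toL_X_pow (K := K) 1
  rw [pow_one] at h
  rw [theta_toL, Diff.expand, h, Diff.rat]
  have := single_mul_single_neg (K := K) 1
  simp only [Nat.cast_one]
  linear_combination (HahnSeries.C ω.yP * (toL x - HahnSeries.C ω.xP)⁻¹ +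
    Polynomial.aeval (toL x) ω.hol) * toL (PowerSeries.derivative K x) * HahnSeries.single 1 1 * this

theorem reflect_single_one : reflect (HahnSeries.single 1 (1 : K)) = -HahnSeries.single 1 1 := by
  ext k
  rw [coeff_reflect]
  by_cases hk : k = 1
  · subst hk; simp
  · simp [HahnSeries.coeff_single_of_ne hk]

theorem reflect_theta (f : LaurentSeries K) : reflect (theta f) = theta (reflect f) := by
  ext k
  simp only [coeff_reflect, coeff_theta]
  ring

theorem reflect_toL {x : K⟦X⟧} (hx : ∀ n, Odd n → PowerSeries.coeff n x = 0) :
    reflect (toL x) = toL x := by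
  ext k
  rw [coeff_reflect]
  rcases lt_or_ge k 0 with h | h
  · simp [coeff_toL_of_neg _ h]
  · lift k to ℕ using h
    rw [coeff_toL_natCast]
    rcases Nat.even_or_odd k with h | h
    · rw [Int.negOnePow_even _ (by exact_mod_cast h)]; simp
    · simp [hx k h]

/-- The only odd factors are `x'(t)` and `t^(-p)`, and their signs cancel. -/
theorem reflect_frobeniusTerm {p : ℕ} (hp : Odd p) (F : K[X]) (ω : Diff K) {x : K⟦X⟧}
    (hx : ∀ n, Odd n → PowerSeries.coeff n x = 0) (i : ℕ) :
    reflect (ω.frobeniusTerm p F x PowerSeries.X i) = ω.frobeniusTerm p F x PowerSeries.X i := by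
  have ht : HahnSeries.single (1 : ℤ) (1 : K) ≠ 0 := HahnSeries.single_ne_zero one_ne_zero
  have hd : reflect (toL (PowerSeries.derivative K x)) = -toL (PowerSeries.derivative K x) := by
    have h := reflect_theta (toL x)
    rw [reflect_toL hx, theta_toL, map_mul, reflect_single_one] at h
    have h2 : HahnSeries.single (1 : ℤ) (1 : K) * reflect (toL (PowerSeries.derivative K x)) =
        HahnSeries.single 1 1 * -toL (PowerSeries.derivative K x) := by linear_combination -h
    exact mul_left_cancel₀ ht h2
  rw [Diff.frobeniusTerm, toL_X]
  simp only [map_mul, map_add, map_sub, map_pow, map_inv₀, reflect_C, reflect_aeval, reflect_toL hx,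
    reflect_single_one, hd, map_natCast, hp.neg_pow, (even_two_mul p).neg_pow]
  rw [inv_neg]
  ring

end Terms

/-! ### Levels of the factors of `φ^*ω` -/

section Bounds

variable {p : ℕ} [Fact p.Prime] {K : Type*} [NormedField K] [NormedAlgebra ℚ_[p] K]

/-- An integral series in `t²` with centre on the reduction of a Weierstrass point, or a constant. -/
structure Admissible (F : K[X]) (x : K⟦X⟧) : Prop where
  norm_le : ∀ n, ‖PowerSeries.coeff n x‖ ≤ 1
  odd : ∀ n, Odd n → PowerSeries.coeff n x = 0
  center : ‖F.eval (PowerSeries.constantCoeff x)‖ < 1 ∨ theta (toL x) = 0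

variable {q : ℝ≥0} {N M : ℤ}

theorem filt_prime : Filt p (p : ℝ≥0)⁻¹ (2 * p) (p : LaurentSeries K) := fun k ↦ by
  rw [← map_natCast (HahnSeries.C (Γ := ℤ) (R := K)) p]
  by_cases hk : k = 0
  · subst hk
    refine ⟨1, by simp, ?_⟩
    rw [← NNReal.coe_le_coe]
    simp only [HahnSeries.C_apply, HahnSeries.coeff_single_same]
    push_cast
    rw [norm_prime (p := p) K, pow_one]
  · obtain ⟨i, hi⟩ := exists_le_add_mul (p := p) (2 * p) k
    refine ⟨i, hi, ?_⟩
    rw [HahnSeries.C_apply, HahnSeries.coeff_single_of_ne hk, nnnorm_zero]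
    exact zero_le

theorem bdd_prime : Bdd (p : ℝ)⁻¹ (p : LaurentSeries K) := by
  rw [← map_natCast (HahnSeries.C (Γ := ℤ) (R := K)) p]
  exact bdd_C (norm_prime K).le

variable (p) in
theorem inv_prime_le_one : (p : ℝ≥0)⁻¹ ≤ 1 :=
  inv_le_one_of_one_le₀ (by exact_mod_cast (Fact.out : p.Prime).one_le)

theorem norm_ratCast_choose_le (hp : p ≠ 2) (i : ℕ) :
    ‖((Ring.choose (-1 / 2 : ℚ) i : ℚ) : K)‖ ≤ 1 := by
  obtain ⟨h, hh⟩ := exists_neg_half hp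
  rw [ratCast_choose K hh]
  exact norm_padicIntTo_le_one K _

variable [IsUltrametricDist K] {f : ℤ_[p][X]}

theorem norm_eval_pow_lt_one {z : K} (hz : ‖z‖ ≤ 1) (hfz : ‖(f.map (padicIntTo p K)).eval z‖ < 1) :
    ‖(f.map (padicIntTo p K)).eval (z ^ p)‖ < 1 := by
  obtain ⟨E, hE⟩ := exists_expand_sub_pow f
  have h := aeval_pow_sub (K := K) hE z
  simp only [Polynomial.coe_aeval_eq_eval] at h
  rw [sub_eq_iff_eq_add.1 h]
  have hp : (1 : ℝ) < p := by exact_mod_cast (Fact.out : p.Prime).one_lt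
  refine (IsUltrametricDist.norm_add_le_max _ _).trans_lt (max_lt ?_ ?_)
  · rw [norm_mul, norm_prime (p := p) K]
    exact (mul_le_of_le_one_right (by positivity)
      (norm_eval_le_one (norm_padicIntTo_le_one K) E hz)).trans_lt (inv_lt_one_of_one_lt₀ hp)
  · rw [norm_pow]
    exact pow_lt_one₀ (norm_nonneg _) hfz (Fact.out : p.Prime).ne_zero

/-- The factor `p` in the numerator has level `2p` and cancels the level `-2p` of `t^(-2p)`. -/
theorem filt_frobeniusError {z : LaurentSeries K} (hz : Filt p (p : ℝ≥0)⁻¹ 0 z) :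
    Filt p (p : ℝ≥0)⁻¹ 0 (frobeniusError p (f.map (padicIntTo p K)) z) := by
  obtain ⟨E, hE⟩ := exists_expand_sub_pow f
  rw [frobeniusError, aeval_pow_sub hE]
  exact ((filt_prime.mul (filt_aeval (norm_padicIntTo_le_one K) E hz)).mul (filt_single _)).mono
    (by linarith)

theorem bdd_frobeniusError {z : LaurentSeries K} (hz : Filt p (p : ℝ≥0)⁻¹ 0 z) :
    Bdd (p : ℝ)⁻¹ (frobeniusError p (f.map (padicIntTo p K)) z) := by
  obtain ⟨E, hE⟩ := exists_expand_sub_pow f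
  rw [frobeniusError, aeval_pow_sub hE]
  exact (bdd_prime.mul_left ((filt_aeval (norm_padicIntTo_le_one K) E hz).bdd
    (inv_prime_le_one p))).mul_left ((filt_single (p := p) (q := 0) _).bdd zero_le)

theorem filt_frobeniusError_sub {z w : LaurentSeries K} (hz : Filt p (p : ℝ≥0)⁻¹ 0 z)
    (hw : Filt p (p : ℝ≥0)⁻¹ 0 w) (h : Filt p (p : ℝ≥0)⁻¹ M (z - w)) :
    Filt p (p : ℝ≥0)⁻¹ M (frobeniusError p (f.map (padicIntTo p K)) z -
      frobeniusError p (f.map (padicIntTo p K)) w) := by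
  obtain ⟨E, hE⟩ := exists_expand_sub_pow f
  rw [frobeniusError, frobeniusError, aeval_pow_sub hE, aeval_pow_sub hE, ← sub_mul, ← mul_sub]
  have := (filt_prime.mul (filt_aeval_sub (norm_padicIntTo_le_one K) E hz hw h)).mul
    (filt_single (-(2 * p : ℤ)))
  exact this.mono (by linarith)

variable {xP yP : ℤ_[p]} {hol : ℤ_[p][X]}

theorem norm_coeff_pow_le_one (p : ℕ) [Fact p.Prime] {K : Type*} [NormedField K]
    [IsUltrametricDist K] {x : K⟦X⟧} (hx : ∀ n, ‖PowerSeries.coeff n x‖ ≤ 1) (m n : ℕ) :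
    ‖PowerSeries.coeff n (x ^ m)‖ ≤ 1 := by
  refine norm_coeff_le_one_of_filt (p := p) _ ?_ n
  rw [toL_pow]
  simpa using (filt_toL (p := p) (q := 0) (N := 0) hx fun n hn ↦ by omega).pow m

theorem filt_inv_sub_C (hP : yP ^ 2 = f.eval xP) (hyP : IsUnit yP) {x : K⟦X⟧}
    (hx : ∀ n, ‖PowerSeries.coeff n x‖ ≤ 1)
    (hc : ‖(f.map (padicIntTo p K)).eval (PowerSeries.constantCoeff x)‖ < 1) :
    Filt p q 0 (toL x - HahnSeries.C (padicIntTo p K xP))⁻¹ := by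
  rw [← toL_C, ← toL_sub]
  refine filt_inv_toL (fun n ↦ ?_) ?_
  · rw [map_sub]
    refine (norm_sub_le_max_of_ultrametric _ _).trans (max_le (hx n) ?_)
    rw [PowerSeries.coeff_C]
    split_ifs
    · exact norm_padicIntTo_le_one K xP
    · simp
  · rw [map_sub, PowerSeries.constantCoeff_C]
    exact norm_sub_eq_one hP hyP (by simpa using hx 0) hc

theorem filt_rat (hP : yP ^ 2 = f.eval xP) (hyP : IsUnit yP) {x : K⟦X⟧}
    (hx : ∀ n, ‖PowerSeries.coeff n x‖ ≤ 1)
    (hc : ‖(f.map (padicIntTo p K)).eval (PowerSeries.constantCoeff x)‖ < 1) :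
    Filt p q 0 ((diffOfPadicInt K xP yP hol).rat (toL x)) := by
  refine Filt.add ?_ (filt_aeval (norm_padicIntTo_le_one K) hol (filt_toL hx fun n hn ↦ by omega))
  exact (filt_C (norm_padicIntTo_le_one K yP)).mul (filt_inv_sub_C hP hyP hx hc)

omit [Fact p.Prime] [NormedAlgebra ℚ_[p] K] [IsUltrametricDist K] in
theorem toL_ne_zero {x : K⟦X⟧} (hx : PowerSeries.constantCoeff x ≠ 0) : toL x ≠ 0 := fun h0 ↦ by
  have h2 := congrArg (fun g : LaurentSeries K ↦ g.coeff (0 : ℕ)) h0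
  simp only [coeff_toL_natCast, PowerSeries.coeff_zero_eq_constantCoeff_apply] at h2
  exact hx h2

theorem toL_sub_C_ne_zero (hP : yP ^ 2 = f.eval xP) (hyP : IsUnit yP) {x : K⟦X⟧}
    (hx : ∀ n, ‖PowerSeries.coeff n x‖ ≤ 1)
    (hc : ‖(f.map (padicIntTo p K)).eval (PowerSeries.constantCoeff x)‖ < 1) :
    toL x - HahnSeries.C (padicIntTo p K xP) ≠ 0 := by
  rw [← toL_C, ← toL_sub]
  refine toL_ne_zero fun h0 ↦ ?_
  have h1 := norm_sub_eq_one hP hyP (by simpa using hx 0) hc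
  rw [map_sub, PowerSeries.constantCoeff_C] at h0
  rw [h0, norm_zero] at h1
  exact zero_ne_one h1

/-- The difference of the polar parts is `yP (z - x) / ((x - xP)(z - xP))`, whose denominators are
units. -/
theorem filt_rat_sub (hP : yP ^ 2 = f.eval xP) (hyP : IsUnit yP) {x z : K⟦X⟧}
    (hx : ∀ n, ‖PowerSeries.coeff n x‖ ≤ 1)
    (hcx : ‖(f.map (padicIntTo p K)).eval (PowerSeries.constantCoeff x)‖ < 1)
    (hz : ∀ n, ‖PowerSeries.coeff n z‖ ≤ 1)
    (hcz : ‖(f.map (padicIntTo p K)).eval (PowerSeries.constantCoeff z)‖ < 1)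
    (h : Filt p q M (toL x - toL z)) :
    Filt p q M ((diffOfPadicInt K xP yP hol).rat (toL x) -
      (diffOfPadicInt K xP yP hol).rat (toL z)) := by
  have hx0 := toL_sub_C_ne_zero hP hyP hx hcx
  have hz0 := toL_sub_C_ne_zero hP hyP hz hcz
  have e : (diffOfPadicInt K xP yP hol).rat (toL x) - (diffOfPadicInt K xP yP hol).rat (toL z) =
      HahnSeries.C (padicIntTo p K yP) * (toL x - HahnSeries.C (padicIntTo p K xP))⁻¹ *
        (toL z - HahnSeries.C (padicIntTo p K xP))⁻¹ * (-(toL x - toL z)) +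
      (Polynomial.aeval (toL x) (hol.map (padicIntTo p K)) -
        Polynomial.aeval (toL z) (hol.map (padicIntTo p K))) := by
    simp only [Diff.rat, diffOfPadicInt]
    field_simp
    ring
  rw [e]
  refine Filt.add ?_ (filt_aeval_sub (norm_padicIntTo_le_one K) hol
    (filt_toL hx fun n hn ↦ by omega) (filt_toL hz fun n hn ↦ by omega) h)
  simpa using (((filt_C (norm_padicIntTo_le_one K yP)).mul (filt_inv_sub_C hP hyP hx hcx)).mul
    (filt_inv_sub_C hP hyP hz hcz)).mul h.neg

end Bounds

/-! ### Bounds for `α` and `∫β` along an admissible series -/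

section AdmissibleSeries

variable {p : ℕ} [Fact p.Prime] {K : Type*} [NormedField K] [NormedAlgebra ℚ_[p] K]
  [IsUltrametricDist K] {f : ℤ_[p][X]} {x z : K⟦X⟧} {q : ℝ≥0} {N M : ℤ}
  {xP yP : ℤ_[p]} {hol : ℤ_[p][X]}

omit [IsUltrametricDist K] in
theorem Admissible.filt (hx : Admissible (f.map (padicIntTo p K)) x) : Filt p q 0 (toL x) :=
  filt_toL hx.norm_le fun n hn ↦ by omega

theorem Admissible.filt_theta (hx : Admissible (f.map (padicIntTo p K)) x) :
    Filt p q 2 (theta (toL x)) := by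
  refine filt_of_norm_le_one ((hx.filt (q := 0)).theta.norm_coeff_le_one zero_le) fun k hk ↦ ?_
  rw [coeff_theta]
  rcases lt_or_ge k 0 with h | h
  · simp [coeff_toL_of_neg _ h]
  · obtain rfl | rfl : k = 0 ∨ k = 1 := by omega
    · simp
    · rw [show (1 : ℤ) = ((1 : ℕ) : ℤ) by simp, coeff_toL_natCast, hx.odd 1 odd_one, mul_zero]

/-- The part of the terms of `φ^* ω` that is a function of `x`. -/
def frobeniusCore (p : ℕ) (F : K[X]) (ω : Diff K) (x : K⟦X⟧) (i : ℕ) : LaurentSeries K :=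
  ω.rat (toL x ^ p) * toL x ^ (p - 1) * frobeniusError p F (toL x) ^ i

section Center

variable (hP : yP ^ 2 = f.eval xP) (hyP : IsUnit yP)
  (hx : ∀ n, ‖PowerSeries.coeff n x‖ ≤ 1)
  (hcx : ‖(f.map (padicIntTo p K)).eval (PowerSeries.constantCoeff x)‖ < 1)
  (hz : ∀ n, ‖PowerSeries.coeff n z‖ ≤ 1)
  (hcz : ‖(f.map (padicIntTo p K)).eval (PowerSeries.constantCoeff z)‖ < 1)

include hx hcx in
theorem norm_eval_constantCoeff_pow_lt_one :
    ‖(f.map (padicIntTo p K)).eval (PowerSeries.constantCoeff (x ^ p))‖ < 1 := by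
  rw [map_pow]
  exact norm_eval_pow_lt_one (by simpa using hx 0) hcx

include hP hyP hx hcx

theorem filt_frobeniusCore (i : ℕ) : Filt p (p : ℝ≥0)⁻¹ 0
    (frobeniusCore p (f.map (padicIntTo p K)) (diffOfPadicInt K xP yP hol) x i) := by
  have h1 := filt_rat (q := (p : ℝ≥0)⁻¹) (hol := hol) hP hyP (norm_coeff_pow_le_one p hx p)
    (norm_eval_constantCoeff_pow_lt_one hx hcx)
  have h2 : Filt p (p : ℝ≥0)⁻¹ 0 (toL x) := filt_toL hx fun n hn ↦ by omega
  rw [toL_pow] at h1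
  exact ((h1.mul (h2.pow (p - 1))).mul ((filt_frobeniusError (f := f) h2).pow i)).mono (by simp)

include hz hcz in
theorem filt_frobeniusCore_sub (h : Filt p (p : ℝ≥0)⁻¹ M (toL x - toL z)) (i : ℕ) :
    Filt p (p : ℝ≥0)⁻¹ M
      (frobeniusCore p (f.map (padicIntTo p K)) (diffOfPadicInt K xP yP hol) x i -
        frobeniusCore p (f.map (padicIntTo p K)) (diffOfPadicInt K xP yP hol) z i) := by
  have hx0 : Filt p (p : ℝ≥0)⁻¹ 0 (toL x) := filt_toL hx fun n hn ↦ by omega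
  have hz0 : Filt p (p : ℝ≥0)⁻¹ 0 (toL z) := filt_toL hz fun n hn ↦ by omega
  have ex := filt_rat (q := (p : ℝ≥0)⁻¹) (hol := hol) hP hyP (norm_coeff_pow_le_one p hx p)
    (norm_eval_constantCoeff_pow_lt_one hx hcx)
  have ez := filt_rat (q := (p : ℝ≥0)⁻¹) (hol := hol) hP hyP (norm_coeff_pow_le_one p hz p)
    (norm_eval_constantCoeff_pow_lt_one hz hcz)
  have e := filt_rat_sub (q := (p : ℝ≥0)⁻¹) (M := M) (hol := hol) hP hyP
    (norm_coeff_pow_le_one p hx p)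
    (norm_eval_constantCoeff_pow_lt_one hx hcx) (norm_coeff_pow_le_one p hz p)
    (norm_eval_constantCoeff_pow_lt_one hz hcz)
    (by rw [toL_pow, toL_pow]; exact hx0.pow_sub_pow hz0 h p)
  rw [toL_pow] at ex ez
  rw [toL_pow, toL_pow] at e
  have a1 := filt_frobeniusError (f := f) hx0
  have a2 := filt_frobeniusError (f := f) hz0
  have a := a1.pow_sub_pow a2 (filt_frobeniusError_sub hx0 hz0 h) i
  have b := hx0.pow_sub_pow hz0 h (p - 1)
  simp only [frobeniusCore]
  set F := f.map (padicIntTo p K)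
  set ω := diffOfPadicInt K xP yP hol
  have key : ω.rat (toL x ^ p) * toL x ^ (p - 1) * frobeniusError p F (toL x) ^ i -
      ω.rat (toL z ^ p) * toL z ^ (p - 1) * frobeniusError p F (toL z) ^ i =
      (ω.rat (toL x ^ p) - ω.rat (toL z ^ p)) * (toL x ^ (p - 1) * frobeniusError p F (toL x) ^ i)
      + ω.rat (toL z ^ p) * ((toL x ^ (p - 1) - toL z ^ (p - 1)) * frobeniusError p F (toL x) ^ i)
      + ω.rat (toL z ^ p) * (toL z ^ (p - 1) *
        (frobeniusError p F (toL x) ^ i - frobeniusError p F (toL z) ^ i)) := by ring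
  rw [key]
  refine Filt.add (Filt.add ?_ ?_) ?_
  · exact (e.mul ((hx0.pow _).mul (a1.pow i))).mono (by simp)
  · exact (ez.mul (b.mul (a1.pow i))).mono (by simp)
  · exact (ez.mul ((hz0.pow _).mul a)).mono (by simp)

end Center

variable (hp : p ≠ 2) (hP : yP ^ 2 = f.eval xP) (hyP : IsUnit yP)
  (hx : Admissible (f.map (padicIntTo p K)) x)

include hp hP hyP hx

/-- The level is `2p` from `p`, `-p` from `t^(-p)`, and `2` from `t dx/dt`, since `x` is even. -/
theorem Admissible.filt_term (i : ℕ) : Filt p (p : ℝ≥0)⁻¹ (p + 2) (HahnSeries.single 1 1 *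
    (diffOfPadicInt K xP yP hol).frobeniusTerm p (f.map (padicIntTo p K)) x PowerSeries.X i) := by
  rw [single_mul_frobeniusTerm]
  rcases hx.center with hc | h0
  · exact ((((filt_prime.mul (filt_single _)).mul (filt_C (norm_ratCast_choose_le hp i))).mul
      (filt_frobeniusCore hP hyP hx.norm_le hc i)).mul hx.filt_theta).mono (by linarith)
  · rw [h0, mul_zero]; exact Filt.zero

/-- The level is independent of `i`; this second estimate, uniform in the degree, gives convergence
of the binomial expansion. -/
theorem Admissible.bdd_term (i : ℕ) : Bdd ((p : ℝ)⁻¹ ^ (i + 1)) (HahnSeries.single 1 1 *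
    (diffOfPadicInt K xP yP hol).frobeniusTerm p (f.map (padicIntTo p K)) x PowerSeries.X i) := by
  rw [single_mul_frobeniusTerm]
  rcases hx.center with hc | h0
  · have h1 := filt_rat (q := (p : ℝ≥0)⁻¹) (hol := hol) hP hyP (norm_coeff_pow_le_one p hx.norm_le p)
      (norm_eval_constantCoeff_pow_lt_one hx.norm_le hc)
    rw [toL_pow] at h1
    have hq := inv_prime_le_one p
    have h2 : Bdd 1 ((diffOfPadicInt K xP yP hol).rat (toL x ^ p) * toL x ^ (p - 1)) :=
      (h1.mul ((hx.filt (q := (p : ℝ≥0)⁻¹)).pow (p - 1))).bdd hq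
    have h3 := h2.mul_right ((bdd_frobeniusError (f := f) hx.filt).pow i)
    rw [pow_succ']
    exact (((bdd_prime.mul_left ((filt_single (p := p) (q := 0) _).bdd zero_le)).mul_left
      (bdd_C (norm_ratCast_choose_le hp i))).mul h3).mul_left
      ((hx.filt_theta (q := (p : ℝ≥0)⁻¹)).bdd hq)
  · rw [h0, mul_zero]; exact bdd_zero (by positivity)

omit hp in
-- The pole `t⁻²` in `t⁻² · rat(x) · (t dx/dt)` is absorbed because `t dx/dt` starts in degree 2.
theorem Admissible.filt_expand :
    Filt p q 0 ((diffOfPadicInt K xP yP hol).expand x PowerSeries.X) := by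
  have e : (diffOfPadicInt K xP yP hol).expand x PowerSeries.X = HahnSeries.single (-2) 1 *
      (HahnSeries.single 1 1 ^ 2 * (diffOfPadicInt K xP yP hol).expand x PowerSeries.X) := by
    rw [← mul_assoc, HahnSeries.single_pow, HahnSeries.single_mul_single]
    simp
  rw [e, single_mul_expand]
  rcases hx.center with hc | h0
  · exact ((filt_single (-2)).mul ((filt_rat hP hyP hx.norm_le hc).mul hx.filt_theta)).mono
      (by norm_num)
  · rw [h0, mul_zero, mul_zero]; exact Filt.zero

variable [CompleteSpace K]

theorem Admissible.summable_alpha (k : ℤ) : Summable fun i ↦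
    ((diffOfPadicInt K xP yP hol).frobeniusTerm p (f.map (padicIntTo p K)) x
      PowerSeries.X i).coeff k := by
  refine NonarchimedeanAddGroup.summable_of_tendsto_cofinite_zero ?_
  rw [Nat.cofinite_eq_atTop]
  have hp1 : 1 < (p : ℝ) := by exact_mod_cast (Fact.out : p.Prime).one_lt
  refine squeeze_zero_norm (a := fun i ↦ (p : ℝ)⁻¹ ^ (i + 1)) (fun i ↦ ?_)
    ((tendsto_pow_atTop_nhds_zero_of_lt_one (by positivity)
      (inv_lt_one_of_one_lt₀ hp1)).comp (Filter.tendsto_add_atTop_nat 1))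
  have := hx.bdd_term (hol := hol) hp hP hyP i (k + 1)
  rwa [coeff_single_one_mul, add_sub_cancel_right] at this

omit [CompleteSpace K] hp in
theorem Admissible.alphaCoeff_neg {k : ℤ} (hk : 0 ≤ k) :
    alphaCoeff p (f.map (padicIntTo p K)) (diffOfPadicInt K xP yP hol) x PowerSeries.X (-1 - k) =
      ∑' i, (HahnSeries.single 1 1 * (diffOfPadicInt K xP yP hol).frobeniusTerm p
        (f.map (padicIntTo p K)) x PowerSeries.X i).coeff (-k) := by
  rw [alphaCoeff, (hx.filt_expand (hol := hol) hP hyP).coeff_eq_zero (by omega), mul_zero, sub_zero]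
  congr 1
  ext i
  rw [coeff_single_one_mul]
  congr 1
  ring

omit [CompleteSpace K] in
-- Parity of `φ^*ω`; this is what makes the constant of integration irrelevant.
theorem Admissible.alphaCoeff_neg_one :
    alphaCoeff p (f.map (padicIntTo p K)) (diffOfPadicInt K xP yP hol) x PowerSeries.X (-1) = 0 := by
  have : CharZero K := charZero_of_injective_algebraMap (algebraMap ℚ_[p] K).injective
  have hodd : Odd p := (Fact.out : p.Prime).odd_of_ne_two hp
  rw [alphaCoeff, (hx.filt_expand (hol := hol) hP hyP).coeff_eq_zero (by omega), mul_zero, sub_zero]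
  convert! tsum_zero with i
  exact coeff_eq_zero_of_reflect_eq (reflect_frobeniusTerm hodd _ _ hx.odd i) (by decide)

omit [CompleteSpace K] in
theorem Admissible.norm_alphaCoeff_le {k : ℤ} (hk : 0 ≤ k) {j : ℕ}
    (h : 2 * p * ((j : ℤ) - 1) - k < p + 2) :
    ‖alphaCoeff p (f.map (padicIntTo p K)) (diffOfPadicInt K xP yP hol) x PowerSeries.X (-1 - k)‖
      ≤ (p : ℝ)⁻¹ ^ j := by
  rw [hx.alphaCoeff_neg hP hyP hk]
  refine IsUltrametricDist.norm_tsum_le_of_forall_le fun i ↦ ?_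
  have := (hx.filt_term (hol := hol) hp hP hyP i).norm_coeff_le (inv_prime_le_one p)
    (k := -k) (i := j) (by linarith)
  simpa using! this

omit [CompleteSpace K] hp in
theorem Admissible.primitiveCoeff_of_neg (c : K) {k : ℤ} (hk : k < 0) :
    primitiveCoeff (diffOfPadicInt K xP yP hol) c x PowerSeries.X k = 0 := by
  rw [primitiveCoeff, if_neg hk.ne,
    (hx.filt_expand (hol := hol) hP hyP).coeff_eq_zero (by omega), zero_div]

end AdmissibleSeries

/-! ### Convergence of the residue, and dependence of `α` on the coordinates -/

section Convergence

variable {p : ℕ} [Fact p.Prime] {K : Type*} [NormedField K] [NormedAlgebra ℚ_[p] K]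
  [IsUltrametricDist K] {f : ℤ_[p][X]} {x z : K⟦X⟧}
  {xP yP xQ yQ : ℤ_[p]} {hω hβ : ℤ_[p][X]}

theorem natCast_ne_zero_of_pos (p : ℕ) [Fact p.Prime] (K : Type*) [NormedField K]
    [NormedAlgebra ℚ_[p] K] {k : ℕ} (hk : k ≠ 0) : (k : K) ≠ 0 := by
  have : CharZero K := charZero_of_injective_algebraMap (algebraMap ℚ_[p] K).injective
  exact_mod_cast hk

theorem Admissible.norm_primitiveCoeff_le (hQ : yQ ^ 2 = f.eval xQ) (hyQ : IsUnit yQ)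
    (hx : Admissible (f.map (padicIntTo p K)) x) (c : K) {k : ℕ} (hk : k ≠ 0) :
    ‖primitiveCoeff (diffOfPadicInt K xQ yQ hβ) c x PowerSeries.X k‖ ≤ ‖(k : K)‖⁻¹ := by
  rw [primitiveCoeff, if_neg (by exact_mod_cast hk), norm_div, div_eq_mul_inv]
  refine (mul_le_of_le_one_left (by positivity)
    ((hx.filt_expand (q := 0) (hol := hβ) hQ hyQ).norm_coeff_le_one zero_le _)).trans ?_
  simp

variable (hp : p ≠ 2) (hP : yP ^ 2 = f.eval xP) (hyP : IsUnit yP)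
  (hQ : yQ ^ 2 = f.eval xQ) (hyQ : IsUnit yQ)

include hp hP hyP hQ hyQ in
-- The `k`-th term is at most `p^(-⌊k/(2p)⌋) · k`, since `|k|⁻¹ ≤ k`; the terms tend to zero, which
-- suffices in a complete ultrametric field.
theorem Admissible.residueConverges [CompleteSpace K]
    (hx : Admissible (f.map (padicIntTo p K)) x) (c : K) :
    ResidueConverges p (f.map (padicIntTo p K)) (diffOfPadicInt K xP yP hω)
      (diffOfPadicInt K xQ yQ hβ) c x PowerSeries.X where
  summable_alpha := hx.summable_alpha hp hP hyP
  no_log := (hx.filt_expand (q := 0) hQ hyQ).coeff_eq_zero (by omega)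
  summable_residue := by
    have hp1 : 1 < (p : ℝ) := by exact_mod_cast (Fact.out : p.Prime).one_lt
    have hpos : 0 < 2 * p := by have := (Fact.out : p.Prime).pos; omega
    refine Summable.of_nat_of_neg_add_one ?_ ?_
    · refine NonarchimedeanAddGroup.summable_of_tendsto_cofinite_zero ?_
      rw [Nat.cofinite_eq_atTop]
      have hlim : Filter.Tendsto (fun j : ℕ ↦ (2 * p : ℝ) * (j * (p : ℝ)⁻¹ ^ j + (p : ℝ)⁻¹ ^ j))
          Filter.atTop (nhds 0) := by
        have h1 := tendsto_self_mul_const_pow_of_lt_one (r := (p : ℝ)⁻¹) (by positivity)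
          (inv_lt_one_of_one_lt₀ hp1)
        have h2 := tendsto_pow_atTop_nhds_zero_of_lt_one (r := (p : ℝ)⁻¹) (by positivity)
          (inv_lt_one_of_one_lt₀ hp1)
        simpa using (h1.add h2).const_mul (2 * p : ℝ)
      refine squeeze_zero_norm (fun k ↦ ?_)
        (hlim.comp (Nat.tendsto_div_const_atTop (n := 2 * p) hpos.ne'))
      simp only [Function.comp]
      rcases Nat.eq_zero_or_pos k with rfl | hk
      · have := hx.alphaCoeff_neg_one (hol := hω) hp hP hyP
        simp [this]
      · have hd : k < 2 * p * (k / (2 * p) + 1) := Nat.lt_mul_div_succ k hpos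
        have hd' : 2 * p * (k / (2 * p)) ≤ k := Nat.mul_div_le k _
        have h1 := hx.norm_alphaCoeff_le (hol := hω) hp hP hyP (k := k) (j := k / (2 * p))
          (by positivity) (by
            have : ((2 * p * (k / (2 * p)) : ℕ) : ℤ) ≤ k := by exact_mod_cast hd'
            push_cast at this
            push_cast
            linarith)
        have h2 := hx.norm_primitiveCoeff_le (hβ := hβ) hQ hyQ c hk.ne'
        have h3 : ‖(k : K)‖⁻¹ ≤ k := inv_le_of_inv_le₀ (by exact_mod_cast hk)
          (inv_le_norm_natCast p K hk.ne')
        have h4 : (k : ℝ) ≤ 2 * p * ((k / (2 * p) : ℕ) + 1) := by exact_mod_cast hd.le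
        rw [norm_mul]
        calc _ ≤ (p : ℝ)⁻¹ ^ (k / (2 * p)) * (2 * p * ((k / (2 * p) : ℕ) + 1)) :=
              mul_le_mul h1 (h2.trans (h3.trans h4)) (norm_nonneg _) (by positivity)
          _ = _ := by ring
    · convert! summable_zero with k
      rw [hx.primitiveCoeff_of_neg hQ hyQ _ (by omega), mul_zero]

include hp hP hyP

/-- The change in `t dx/dt` is tracked separately as `N`, because differentiation may gain a factor
`p`. The change in the remaining factors is multiplied by `t dz/dt`, of level 2, whence `N ≤ M + 2`.
-/
theorem filt_term_sub {M N : ℤ} (hx : Admissible (f.map (padicIntTo p K)) x)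
    (hcx : ‖(f.map (padicIntTo p K)).eval (PowerSeries.constantCoeff x)‖ < 1)
    (hz : Admissible (f.map (padicIntTo p K)) z) (hM : Filt p (p : ℝ≥0)⁻¹ M (toL x - toL z))
    (hN : Filt p (p : ℝ≥0)⁻¹ N (theta (toL x) - theta (toL z))) (hNM : N ≤ M + 2) (i : ℕ) :
    Filt p (p : ℝ≥0)⁻¹ (N + p) (HahnSeries.single 1 1 *
      (diffOfPadicInt K xP yP hω).frobeniusTerm p (f.map (padicIntTo p K)) x PowerSeries.X i -
      HahnSeries.single 1 1 *
      (diffOfPadicInt K xP yP hω).frobeniusTerm p (f.map (padicIntTo p K)) z PowerSeries.X i) := by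
  rw [single_mul_frobeniusTerm, single_mul_frobeniusTerm]
  have h0 := (filt_prime (p := p) (K := K)).mul (filt_single (-(p : ℤ)))
  have h1 := h0.mul (filt_C (norm_ratCast_choose_le (K := K) hp i))
  have h2 := filt_frobeniusCore (hol := hω) hP hyP hx.norm_le hcx i
  have key : ∀ A P Q X Z : LaurentSeries K,
      A * P * X - A * Q * Z = A * (P * (X - Z) + (P - Q) * Z) := fun A P Q X Z ↦ by ring
  rw [key]
  refine (h1.mul (M := N) (Filt.add ?_ ?_)).mono (by linarith)
  · exact (h2.mul hN).mono (by simp)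
  · rcases hz.center with hcz | hcz
    · exact ((filt_frobeniusCore_sub (hol := hω) hP hyP hx.norm_le hcx hz.norm_le hcz hM i).mul
        hz.filt_theta).mono hNM
    · rw [hcz, mul_zero]; exact Filt.zero

theorem norm_alphaCoeff_sub_le [CompleteSpace K] {M N : ℤ}
    (hx : Admissible (f.map (padicIntTo p K)) x)
    (hcx : ‖(f.map (padicIntTo p K)).eval (PowerSeries.constantCoeff x)‖ < 1)
    (hz : Admissible (f.map (padicIntTo p K)) z) (hM : Filt p (p : ℝ≥0)⁻¹ M (toL x - toL z))
    (hN : Filt p (p : ℝ≥0)⁻¹ N (theta (toL x) - theta (toL z))) (hNM : N ≤ M + 2) {k : ℤ}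
    (hk : 0 ≤ k) {j : ℕ} (h : 2 * p * ((j : ℤ) - 1) - k < N + p) :
    ‖alphaCoeff p (f.map (padicIntTo p K)) (diffOfPadicInt K xP yP hω) x PowerSeries.X (-1 - k) -
      alphaCoeff p (f.map (padicIntTo p K)) (diffOfPadicInt K xP yP hω) z PowerSeries.X (-1 - k)‖
      ≤ (p : ℝ)⁻¹ ^ j := by
  have hs : ∀ {w : K⟦X⟧}, Admissible (f.map (padicIntTo p K)) w → Summable fun i ↦
      (HahnSeries.single 1 1 * (diffOfPadicInt K xP yP hω).frobeniusTerm p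
        (f.map (padicIntTo p K)) w PowerSeries.X i).coeff (-k) := fun hw ↦ by
    simp only [coeff_single_one_mul]
    exact hw.summable_alpha hp hP hyP _
  rw [hx.alphaCoeff_neg hP hyP hk, hz.alphaCoeff_neg hP hyP hk, ← (hs hx).tsum_sub (hs hz)]
  refine IsUltrametricDist.norm_tsum_le_of_forall_le fun i ↦ ?_
  have := (filt_term_sub (hω := hω) hp hP hyP hx hcx hz hM hN hNM i).norm_coeff_le
    (inv_prime_le_one p) (k := -k) (i := j) (by linarith)
  simpa using! this

end Convergence

/-! ### Expansion in powers of `S = F(u)` and primitives of `T^(2m) dT` -/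

section Expansion

variable {p : ℕ} [Fact p.Prime] {K : Type*} [NormedField K] [NormedAlgebra ℚ_[p] K]
  [IsUltrametricDist K] {f : ℤ_[p][X]} {x : K⟦X⟧}

omit [NormedAlgebra ℚ_[p] K] in
theorem norm_eq_one_of_isUnit {a : unitBall K} (ha : IsUnit a) : ‖(a : K)‖ = 1 := by
  obtain ⟨b, hb⟩ := ha.exists_right_inv
  have h : ‖(a : K)‖ * ‖(b : K)‖ = 1 := by
    rw [← norm_mul, ← Subring.coe_mul, hb]; simp
  refine le_antisymm a.2 ?_
  rw [← h]
  exact mul_le_of_le_one_right (norm_nonneg _) b.2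

omit [NormedAlgebra ℚ_[p] K] in
theorem coe_eval_unitBall (D : (unitBall K)[X]) (a : unitBall K) :
    (D.map (unitBall K).subtype).eval (a : K) = ((D.eval a : unitBall K) : K) :=
  (Polynomial.eval_map _ _).trans (Polynomial.eval₂_at_apply (unitBall K).subtype a)

/-- A rational function of `u` that is regular on the residue disc of the simple root `a` of `F` is
an integral polynomial in `F(u)` plus a multiple of `F(u) ^ N`. -/
theorem exists_expansion (p : ℕ) [Fact p.Prime] {K : Type*} [NormedField K] [IsUltrametricDist K]
    {a : unitBall K} {Q : (unitBall K)[X]} (hQ : IsUnit (Q.eval a)) {u : K⟦X⟧}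
    (hu : ∀ n, ‖PowerSeries.coeff n u‖ ≤ 1) (hua : ‖PowerSeries.constantCoeff u - a‖ < 1)
    {S : LaurentSeries K} (hS : S = (toL u - HahnSeries.C (a : K)) *
      Polynomial.aeval (toL u) (Q.map (unitBall K).subtype)) (N : ℕ) :
    ∀ P D : (unitBall K)[X], IsUnit (D.eval a) → ∃ c : ℕ → K, (∀ m, ‖c m‖ ≤ 1) ∧
      ∃ r : LaurentSeries K, Filt p 0 0 r ∧
        Polynomial.aeval (toL u) (P.map (unitBall K).subtype) *
          (Polynomial.aeval (toL u) (D.map (unitBall K).subtype))⁻¹ =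
          ∑ m ∈ Finset.range N, HahnSeries.C (c m) * S ^ m + S ^ N * r := by
  have hι : ∀ r, ‖(unitBall K).subtype r‖ ≤ 1 := fun r ↦ r.2
  have hunit : ∀ D : (unitBall K)[X], IsUnit (D.eval a) →
      ‖(D.map (unitBall K).subtype).eval (PowerSeries.constantCoeff u)‖ = 1 := fun D hD ↦ by
    have hu0 : ‖PowerSeries.constantCoeff u‖ ≤ 1 := by simpa using hu 0
    refine le_antisymm (norm_eval_le_one hι D hu0) (not_lt.1 fun hlt ↦ ?_)
    have h1 := (norm_eval_sub_le hι D hu0 a.2).trans_lt hua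
    have h2 := (norm_sub_le_max_of_ultrametric _ _).trans_lt (max_lt hlt h1)
    rw [sub_sub_cancel, coe_eval_unitBall, norm_eq_one_of_isUnit hD] at h2
    exact lt_irrefl _ h2
  have hne : ∀ D : (unitBall K)[X], IsUnit (D.eval a) →
      Polynomial.aeval (toL u) (D.map (unitBall K).subtype) ≠ 0 := fun D hD h0 ↦ by
    have h1 := hunit D hD
    rw [aeval_toL] at h0
    refine toL_ne_zero (fun h2 ↦ ?_) h0
    rw [← constantCoeff_aeval, h2, norm_zero] at h1
    exact zero_ne_one h1
  induction N with
  | zero =>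
    intro P D hD
    refine ⟨0, by simp, _, ?_, by simp; rfl⟩
    exact (filt_aeval hι P (filt_toL hu fun n hn ↦ by omega)).mul
      (filt_inv_aeval hι D hu (hunit D hD))
  | succ N ih =>
    intro P D hD
    obtain ⟨d, hd⟩ := hD.exists_right_inv
    obtain ⟨P1, hP1⟩ : Polynomial.X - Polynomial.C a ∣ P - Polynomial.C (P.eval a * d) * D := by
      rw [Polynomial.dvd_iff_isRoot, Polynomial.IsRoot, Polynomial.eval_sub, Polynomial.eval_mul,
        Polynomial.eval_C]
      linear_combination -(P.eval a) * hd
    -- After the value at `a` is subtracted, the quotient is `(u - a) P1 / D = S · P1 / (D Q)`, to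
    -- which induction applies with the new denominator.
    obtain ⟨c, hc, r, hr, h⟩ := ih P1 (D * Q) (by rw [Polynomial.eval_mul]; exact hD.mul hQ)
    obtain ⟨c', hc0, hc'⟩ : ∃ c' : ℕ → K, c' 0 = ((P.eval a * d : unitBall K) : K) ∧
        ∀ m, c' (m + 1) = c m :=
        ⟨fun m ↦ if m = 0 then ((P.eval a * d : unitBall K) : K) else c (m - 1), by simp, by simp⟩
    refine ⟨c', fun m ↦ ?_, r, hr, ?_⟩
    · cases m with
      | zero => rw [hc0]; exact (P.eval a * d).2
      | succ m => rw [hc']; exact hc m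
    · have h2 := congrArg (fun G : (unitBall K)[X] ↦
        Polynomial.aeval (toL u) (G.map (unitBall K).subtype)) hP1
      simp only [Polynomial.map_sub, Polynomial.map_mul, map_sub, map_mul, Polynomial.map_X,
        Polynomial.map_C, Polynomial.aeval_X, Polynomial.aeval_C, algebraMap_eq_C,
        Subring.subtype_apply] at h2
      simp only [Polynomial.map_mul, map_mul] at h
      have hD0 := hne D hD
      have hQ0 := hne Q hQ
      have key : Polynomial.aeval (toL u) (P.map (unitBall K).subtype) *
          (Polynomial.aeval (toL u) (D.map (unitBall K).subtype))⁻¹ =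
          S * (∑ m ∈ Finset.range N, HahnSeries.C (c m) * S ^ m + S ^ N * r) +
          HahnSeries.C ((P.eval a * d : unitBall K) : K) := by
        rw [← h, hS, Subring.coe_mul, map_mul]
        field_simp
        linear_combination h2
      rw [key, Finset.sum_range_succ', mul_add, Finset.mul_sum, pow_zero, mul_one]
      have hsum : ∀ m, S * (HahnSeries.C (c m) * S ^ m) = HahnSeries.C (c m) * S ^ (m + 1) :=
        fun m ↦ by ring
      simp only [hsum, hc0, hc']
      ring

/-- If `τ² S` is close to `1`, then `S ^ m τ dS` is close to `2 T ^ (2 m) dT`, where `T = S τ`. -/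
theorem bdd_sub_theta {S τ : LaurentSeries K} {r : ℝ} (hr : r ≤ 1) (hS : Bdd 1 S) (hτ : Bdd 1 τ)
    (h : Bdd r (τ ^ 2 * S - 1)) (m : ℕ) :
    Bdd r (S ^ m * (τ * theta S) - 2 * ((S * τ) ^ (2 * m) * theta (S * τ))) := by
  set ε := τ ^ 2 * S - 1 with hε
  have hr0 : 0 ≤ r := (norm_nonneg _).trans (h 0)
  have h1 : Bdd 1 ε := h.mono hr
  have hθ : theta ε = τ ^ 2 * theta S + 2 * (τ * theta τ) * S := by
    have h1' : theta (1 : LaurentSeries K) = 0 := by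
      simpa using! theta_C (1 : K)
    rw [hε, map_sub, h1', theta_mul, pow_two, theta_mul]
    ring
  have two : Bdd 1 (2 : LaurentSeries K) := by
    simpa [one_add_one_eq_two] using! bdd_one.add (bdd_one (K := K))
  have hδ : ∃ δ, Bdd r δ ∧ 2 * theta (S * τ) = τ * theta S + δ := by
    -- Obtained by multiplying `hθ` by `τ S` and replacing `τ² S` by `1 + ε`.
    refine ⟨τ * S * theta ε - τ * ε * theta S - 2 * ε * (S * theta τ), ?_, ?_⟩
    · exact (((hτ.mul_left hS).mul_right h.theta).sub ((hτ.mul_right h).mul_left hS.theta)).sub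
        ((two.mul_right h).mul_left (hS.mul_left hτ.theta))
    · rw [theta_mul, hθ, hε]
      ring
  have hpow : ∃ ρ, Bdd r ρ ∧ (1 + ε) ^ m = 1 + ρ := by
    clear hδ
    induction m with
    | zero => exact ⟨0, bdd_zero hr0, by simp⟩
    | succ m ih =>
      obtain ⟨ρ, h2, h3⟩ := ih
      exact ⟨ρ * (1 + ε) + ε, (h2.mul_left (bdd_one.add h1)).add h, by rw [pow_succ, h3]; ring⟩
  obtain ⟨δ, hδ1, hδ2⟩ := hδ
  obtain ⟨ρ, hρ1, hρ2⟩ := hpow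
  have hT : (S * τ) ^ (2 * m) = S ^ m * (1 + ρ) := by
    rw [← hρ2, hε, pow_mul, ← mul_pow]
    congr 1
    ring
  have key : S ^ m * (τ * theta S) - 2 * ((S * τ) ^ (2 * m) * theta (S * τ)) =
      -(S ^ m * (ρ * (τ * theta S) + (1 + ρ) * δ)) := by
    rw [hT]
    linear_combination -S ^ m * (1 + ρ) * hδ2
  rw [key]
  have hSm : Bdd 1 (S ^ m) := by simpa using hS.pow m
  exact (hSm.mul_right ((hρ1.mul_left (hτ.mul_left hS.theta)).add
    ((bdd_one.add (hρ1.mono hr)).mul_right hδ1))).neg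

theorem bdd_truncated_binomial (hp : p ≠ 2) {e : LaurentSeries K} (he : Filt p (p : ℝ≥0)⁻¹ 0 e)
    (he' : Bdd (p : ℝ)⁻¹ e) (L : ℕ) :
    Bdd ((p : ℝ)⁻¹ ^ L) ((∑ i ∈ Finset.range L,
      HahnSeries.C ((Ring.choose (-1 / 2 : ℚ) i : ℚ) : K) * e ^ i) ^ 2 * (1 + e) - 1) := by
  obtain ⟨h, hh⟩ := exists_neg_half hp
  obtain ⟨R, hR⟩ := exists_truncated_binomial hh L
  have h2 := congrArg (fun P ↦ Polynomial.aeval e (P.map (padicIntTo p K))) hR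
  simp only [Polynomial.map_mul, Polynomial.map_pow, Polynomial.map_add, Polynomial.map_one,
    Polynomial.map_X, Polynomial.map_sum, Polynomial.map_C, map_mul, map_add, map_one, map_pow,
    map_sum, Polynomial.aeval_X, Polynomial.aeval_C, algebraMap_eq_C, ← ratCast_choose K hh] at h2
  rw [h2, add_sub_cancel_left]
  exact (he'.pow L).mul_left ((filt_aeval (norm_padicIntTo_le_one K) R he).bdd (inv_prime_le_one p))

theorem two_mul_add_one_lt_pow (hp : p ≠ 2) (m : ℕ) : 2 * m + 1 < p ^ (m + 1) := by
  have hp3 : 3 ≤ p := by have := (Fact.out : p.Prime).two_le; omega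
  refine lt_of_lt_of_le ?_ (Nat.pow_le_pow_left hp3 (m + 1))
  induction m with
  | zero => norm_num
  | succ m ih => rw [pow_succ]; omega

/-- The bound for the coefficients of a primitive of `T ^ (2 m) dT`. -/
theorem norm_coeff_pow_mul_theta_le (hp : p ≠ 2) {T : LaurentSeries K}
    (hT : Filt p (p : ℝ≥0)⁻¹ p T) {n : ℕ} {k : ℤ} (hk : 2 * p * n - p - 4 ≤ k) (m : ℕ) :
    ‖(T ^ (2 * m) * theta T).coeff (-k)‖ ≤ (p : ℝ)⁻¹ ^ n * ‖(k : K)‖ := by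
  have hp3 : 3 ≤ p := by have := (Fact.out : p.Prime).two_le; omega
  have hp0 : (0 : ℝ) < p := by exact_mod_cast (show 0 < p by omega)
  have h1 := congrArg (fun g ↦ HahnSeries.coeff g (-k)) (theta_pow_succ T (2 * m))
  have h2 : (((2 * m : ℕ) : LaurentSeries K) + 1) * T ^ (2 * m) * theta T =
      HahnSeries.C (((2 * m + 1 : ℕ) : K)) * (T ^ (2 * m) * theta T) := by
    rw [map_natCast]; push_cast; ring
  simp only [h2, coeff_theta, HahnSeries.C_mul_eq_smul, HahnSeries.coeff_smul, smul_eq_mul] at h1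
  have h3 := congrArg norm h1
  rw [norm_mul, norm_mul] at h3
  -- Level `(2m+1)p` gives exponent `n + m` as soon as `k > 2pn - 3p`, which follows from `hk`
  -- because `2p > 4`. The surplus `m` covers the denominator `2m + 1 < p^(m+1)`.
  have h4 : ‖(T ^ (2 * m + 1)).coeff (-k)‖ ≤ (p : ℝ)⁻¹ ^ (n + m) := by
    have := (hT.pow (2 * m + 1)).norm_coeff_le (inv_prime_le_one p) (k := -k) (i := n + m)
      (by push_cast; nlinarith)
    simpa using! this
  have h5 : (p : ℝ)⁻¹ ^ m ≤ ‖((2 * m + 1 : ℕ) : K)‖ :=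
    le_norm_natCast K (by omega) (two_mul_add_one_lt_pow hp m)
  have h6 : 0 < (p : ℝ)⁻¹ ^ m := by positivity
  refine le_of_mul_le_mul_left ?_ h6
  calc (p : ℝ)⁻¹ ^ m * ‖(T ^ (2 * m) * theta T).coeff (-k)‖
      ≤ ‖((2 * m + 1 : ℕ) : K)‖ * ‖(T ^ (2 * m) * theta T).coeff (-k)‖ := by gcongr
    _ = ‖((-k : ℤ) : K)‖ * ‖(T ^ (2 * m + 1)).coeff (-k)‖ := h3.symm
    _ ≤ ‖((-k : ℤ) : K)‖ * (p : ℝ)⁻¹ ^ (n + m) := by gcongr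
    _ = _ := by rw [Int.cast_neg, norm_neg, pow_add]; ring

end Expansion

/-! ### The sharper bound on `α` for the true local coordinates -/

section TrueCoordinates

variable {p : ℕ} [Fact p.Prime] {K : Type*} [NormedField K] [NormedAlgebra ℚ_[p] K]
  [IsUltrametricDist K] {f : ℤ_[p][X]} {x : K⟦X⟧} {xP yP : ℤ_[p]} {hω : ℤ_[p][X]}

/-- The expansion of a regular function of `u = x ^ p` in powers of `F(u)`. -/
theorem exists_expansion_rat [CompleteSpace K] (hf : f.Monic)
    (hgood : (f.map (PadicInt.toZMod (p := p))).Separable)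
    (hP : yP ^ 2 = f.eval xP) (hyP : IsUnit yP) (hx : ∀ n, ‖PowerSeries.coeff n x‖ ≤ 1)
    (hc : (f.map (padicIntTo p K)).eval (PowerSeries.constantCoeff x) = 0) (N : ℕ) :
    ∃ c : ℕ → K, (∀ m, ‖c m‖ ≤ 1) ∧ ∃ r : LaurentSeries K, Filt p 0 0 r ∧
      (diffOfPadicInt K xP yP hω).rat (toL x ^ p) =
        (∑ m ∈ Finset.range N, HahnSeries.C (c m) *
          Polynomial.aeval (toL x ^ p) (f.map (padicIntTo p K)) ^ m +
        Polynomial.aeval (toL x ^ p) (f.map (padicIntTo p K)) ^ N * r) *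
        Polynomial.aeval (toL x ^ p) (f.map (padicIntTo p K)).derivative := by
  set ι := padicIntToUnitBall p K
  have hx0 : ‖PowerSeries.constantCoeff x‖ ≤ 1 := by simpa using hx 0
  have hp1 : (p : ℝ)⁻¹ < 1 :=
    inv_lt_one_of_one_lt₀ (by exact_mod_cast (Fact.out : p.Prime).one_lt)
  set b : unitBall K := ⟨PowerSeries.constantCoeff x ^ p, by
    rw [mem_unitBall, norm_pow]; exact pow_le_one₀ (norm_nonneg _) hx0⟩
  have hFb : ‖(f.map (padicIntTo p K)).eval (b : K)‖ ≤ (p : ℝ)⁻¹ := by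
    obtain ⟨E, hE⟩ := exists_expand_sub_pow f
    have h := aeval_pow_sub (K := K) hE (PowerSeries.constantCoeff x)
    simp only [Polynomial.coe_aeval_eq_eval, hc, zero_pow (Fact.out : p.Prime).ne_zero, sub_zero]
      at h
    rw [h, norm_mul, norm_prime (p := p) K]
    exact mul_le_of_le_one_right (by positivity)
      (norm_eval_le_one (norm_padicIntTo_le_one K) E hx0)
  have hF'b := norm_eval_derivative hgood b.2 (hFb.trans_lt hp1)
  -- The centre `x(0)^p` of `u = x^p` need not be a root of `f`, but it is one modulo `p`, hence
  -- close to a true root.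
  obtain ⟨a, ha, hab⟩ := exists_root_of_norm_le (p := p) (hf.map ι) (b := b)
    (by rwa [coe_eval_map_padicIntToUnitBall]) (isUnit_unitBall (by
      rwa [Polynomial.derivative_map, coe_eval_map_padicIntToUnitBall]))
  have haK : (f.map (padicIntTo p K)).eval (a : K) = 0 := by
    rw [← coe_eval_map_padicIntToUnitBall, ha]; rfl
  have hF'a : IsUnit ((f.derivative.map ι).eval a) := isUnit_unitBall (by
    rw [coe_eval_map_padicIntToUnitBall]
    exact norm_eval_derivative hgood a.2 (by simp [haK]))
  obtain ⟨Q, hQ⟩ : Polynomial.X - Polynomial.C a ∣ f.map ι := Polynomial.dvd_iff_isRoot.2 ha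
  have hQa : Q.eval a = (f.derivative.map ι).eval a := by
    rw [← Polynomial.derivative_map, hQ]
    simp
  have hxP : IsUnit (a - ι xP) := isUnit_unitBall
    (norm_sub_eq_one hP hyP a.2 (by simp [haK]))
  have hev : ∀ G : ℤ_[p][X], Polynomial.aeval (toL x ^ p) ((G.map ι).map (unitBall K).subtype) =
      Polynomial.aeval (toL x ^ p) (G.map (padicIntTo p K)) := fun G ↦ by
    rw [map_padicIntToUnitBall]
  have hS : Polynomial.aeval (toL x ^ p) (f.map (padicIntTo p K)) =
      (toL (x ^ p) - HahnSeries.C (a : K)) * Polynomial.aeval (toL (x ^ p)) (Q.map (unitBall K).subtype) := by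
    rw [← hev, hQ]
    simp [algebraMap_eq_C, toL_pow, -HahnSeries.C_apply]
  -- The extra denominator `f'` converts `du` into `dS / f'(u)`.
  have hD : IsUnit (((Polynomial.X - Polynomial.C (ι xP)) * f.derivative.map ι).eval a) := by
    rw [Polynomial.eval_mul, Polynomial.eval_sub, Polynomial.eval_X, Polynomial.eval_C]
    exact hxP.mul hF'a
  obtain ⟨c, hc1, r, hr, h⟩ := exists_expansion p (a := a) (by rwa [hQa])
    (norm_coeff_pow_le_one p hx p) (by
      rw [map_pow, ← norm_neg, neg_sub]; exact hab.trans_lt hp1) hS N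
    (Polynomial.C (ι yP) + hω.map ι * (Polynomial.X - Polynomial.C (ι xP))) _ hD
  refine ⟨c, hc1, r, hr, ?_⟩
  rw [← h, Polynomial.derivative_map]
  have hxu := norm_coeff_pow_le_one p hx p
  have hcu : ‖(f.map (padicIntTo p K)).eval (PowerSeries.constantCoeff (x ^ p))‖ < 1 := by
    rw [map_pow]; exact hFb.trans_lt hp1
  have n1 : toL x ^ p - HahnSeries.C (padicIntTo p K xP) ≠ 0 := by
    rw [← toL_pow]
    exact toL_sub_C_ne_zero hP hyP hxu hcu
  have n2 : Polynomial.aeval (toL x ^ p) (f.derivative.map (padicIntTo p K)) ≠ 0 := by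
    rw [← toL_pow, aeval_toL]
    refine toL_ne_zero ?_
    rw [constantCoeff_aeval, map_pow]
    intro h0
    rw [h0, norm_zero] at hF'b
    exact zero_ne_one hF'b
  have e2 : ∀ z : ℤ_[p], (unitBall K).subtype (ι z) = padicIntTo p K z := fun z ↦ rfl
  simp only [Polynomial.map_mul, Polynomial.map_add, Polynomial.map_sub, Polynomial.map_X,
    Polynomial.map_C, map_mul, map_add, map_sub, Polynomial.aeval_X, Polynomial.aeval_C,
    algebraMap_eq_C, hev, e2, toL_pow]
  simp only [Diff.rat, diffOfPadicInt]
  field_simp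

variable (hp : p ≠ 2) (hf : f.Monic) (hgood : (f.map (PadicInt.toZMod (p := p))).Separable)
  (hP : yP ^ 2 = f.eval xP) (hyP : IsUnit yP) (hx : Admissible (f.map (padicIntTo p K)) x)
  {a : K} (hloc : IsLocalCoordinates (f.map (padicIntTo p K)) a x PowerSeries.X)
  (ha : (f.map (padicIntTo p K)).eval a = 0)

omit [IsUltrametricDist K] in
include hloc in
theorem aeval_pow_eq_of_curve : Polynomial.aeval (toL x ^ p) (f.map (padicIntTo p K)) =
    HahnSeries.single (2 * p : ℤ) 1 * (1 + frobeniusError p (f.map (padicIntTo p K)) (toL x)) := by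
  have h1 : Polynomial.aeval (toL x) (f.map (padicIntTo p K)) ^ p =
      HahnSeries.single (2 * p : ℤ) 1 := by
    rw [aeval_toL, ← hloc.curve, toL_pow, toL_X, ← pow_mul, HahnSeries.single_pow]
    simp
  have h2 := single_mul_single_neg (K := K) (2 * p)
  rw [frobeniusError, h1]
  linear_combination -(Polynomial.aeval (toL x ^ p) (f.map (padicIntTo p K)) -
    HahnSeries.single (2 * p : ℤ) 1) * h2

/-- The truncation of `1 / φ(y)`. -/
def frobeniusInvY (p : ℕ) (F : K[X]) (x : K⟦X⟧) (L : ℕ) : LaurentSeries K :=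
  HahnSeries.single (-(p : ℤ)) 1 * ∑ i ∈ Finset.range L,
    HahnSeries.C ((Ring.choose (-1 / 2 : ℚ) i : ℚ) : K) * frobeniusError p F (toL x) ^ i

include hp hx hloc in
theorem bdd_frobeniusInvY_sq (L : ℕ) :
    Bdd ((p : ℝ)⁻¹ ^ L) (frobeniusInvY p (f.map (padicIntTo p K)) x L ^ 2 *
      Polynomial.aeval (toL x ^ p) (f.map (padicIntTo p K)) - 1) := by
  rw [aeval_pow_eq_of_curve hloc, frobeniusInvY]
  have h := bdd_truncated_binomial hp (filt_frobeniusError (f := f) (hx.filt))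
    (bdd_frobeniusError (f := f) (hx.filt)) L
  have h2 : HahnSeries.single (-(p : ℤ)) (1 : K) ^ 2 * HahnSeries.single (2 * p : ℤ) 1 = 1 := by
    rw [HahnSeries.single_pow, HahnSeries.single_mul_single]
    simp
  convert! h using 1
  linear_combination (∑ i ∈ Finset.range L, HahnSeries.C ((Ring.choose (-1 / 2 : ℚ) i : ℚ) : K) *
    frobeniusError p (f.map (padicIntTo p K)) (toL x) ^ i) ^ 2 *
      (1 + frobeniusError p (f.map (padicIntTo p K)) (toL x)) * h2

include hp hx in
theorem filt_frobeniusInvY (L : ℕ) :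
    Filt p (p : ℝ≥0)⁻¹ (-p) (frobeniusInvY p (f.map (padicIntTo p K)) x L) := by
  refine ((filt_single (-(p : ℤ))).mul (M := 0) (Filt.sum fun i _ ↦ ?_)).mono (by simp)
  exact ((filt_C (norm_ratCast_choose_le hp i)).mul
    ((filt_frobeniusError (f := f) hx.filt).pow i)).mono (by simp)

omit [NormedAlgebra ℚ_[p] K] [IsUltrametricDist K] in
-- With `u = x^p` one has `p x^(p-1) dx = du` and `F'(u) du = dS`, so the partial sum of `φ^*ω` is
-- `G · τ dS`.
theorem sum_frobeniusTerm_eq (F : K[X]) (ω : Diff K) {G : LaurentSeries K}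
    (hG : ω.rat (toL x ^ p) = G * Polynomial.aeval (toL x ^ p) F.derivative) (L : ℕ) :
    ∑ i ∈ Finset.range L, HahnSeries.single 1 1 * ω.frobeniusTerm p F x PowerSeries.X i =
      G * (frobeniusInvY p F x L * theta (Polynomial.aeval (toL x ^ p) F)) := by
  have hp0 : p = (p - 1) + 1 := by have := (Fact.out : p.Prime).pos; omega
  have h1 : theta (toL x ^ p) = p * toL x ^ (p - 1) * theta (toL x) := by
    conv_lhs => rw [hp0, theta_pow_succ]
    congr 2
    rw [hp0]; push_cast; simp
  simp only [single_mul_frobeniusTerm, frobeniusInvY, theta_aeval, h1, hG, Finset.mul_sum,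
    Finset.sum_mul]
  refine Finset.sum_congr rfl fun i _ ↦ ?_
  ring

include hp hf hgood hP hyP hx hloc ha in
-- The factor `|k|` reflects that `φ^*ω` is, up to negligible errors, the differential of a series
-- in odd powers of `φ(y)`.
theorem norm_alphaCoeff_le_mul_norm [CompleteSpace K] {n : ℕ} {k : ℕ} (hk : k ≠ 0)
    (hkn : 2 * p * n - p - 4 ≤ (k : ℤ)) :
    ‖alphaCoeff p (f.map (padicIntTo p K)) (diffOfPadicInt K xP yP hω) x PowerSeries.X (-1 - k)‖
      ≤ (p : ℝ)⁻¹ ^ n * ‖(k : K)‖ := by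
  have hp1 : (p : ℝ)⁻¹ < 1 :=
    inv_lt_one_of_one_lt₀ (by exact_mod_cast (Fact.out : p.Prime).one_lt)
  have hppos : (0 : ℝ) < p := by exact_mod_cast (Fact.out : p.Prime).pos
  have hpos : 0 < (p : ℝ)⁻¹ ^ n * ‖(k : K)‖ :=
    mul_pos (by positivity) (norm_pos_iff.2 (natCast_ne_zero_of_pos p K hk))
  -- The full `φ^*ω` has infinitely many negative powers and is not a formal Laurent series.
  -- Binomial series and expansion in `S` are therefore cut at one `L`, with errors below the target
  -- for this fixed `k`.
  obtain ⟨L, hL⟩ := exists_pow_lt_of_lt_one hpos hp1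
  set F := f.map (padicIntTo p K)
  set ω := diffOfPadicInt K xP yP hω
  set S := Polynomial.aeval (toL x ^ p) F
  set τ := frobeniusInvY p F x L
  have hq := inv_prime_le_one p
  have hτ : Filt p (p : ℝ≥0)⁻¹ (-p) τ := filt_frobeniusInvY hp hx L
  have hS : Filt p (p : ℝ≥0)⁻¹ (2 * p) S := by
    simp only [S]
    rw [aeval_pow_eq_of_curve hloc]
    refine ((filt_single (2 * p : ℤ)).mul (M := 0) (Filt.add ?_
      (filt_frobeniusError hx.filt))).mono (by simp)
    simpa using! filt_C (K := K) (p := p) (q := (p : ℝ≥0)⁻¹) (c := 1) (by simp)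
  have hT : Filt p (p : ℝ≥0)⁻¹ p (S * τ) := (hS.mul hτ).mono (by linarith)
  have hc0 : F.eval (PowerSeries.constantCoeff x) = 0 := by rw [hloc.center]; exact ha
  obtain ⟨c, hc, r, hr, hG⟩ := exists_expansion_rat (hω := hω) hf hgood hP hyP hx.norm_le hc0 L
  have hsum := sum_frobeniusTerm_eq F ω hG L
  have hs : Summable fun i ↦ (HahnSeries.single 1 1 * ω.frobeniusTerm p F x PowerSeries.X i).coeff
      (-(k : ℤ)) := by
    simp only [coeff_single_one_mul]
    exact hx.summable_alpha hp hP hyP _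
  rw [hx.alphaCoeff_neg hP hyP (by positivity), ← hs.sum_add_tsum_nat_add L]
  have hb : 0 ≤ (p : ℝ)⁻¹ ^ n * ‖(k : K)‖ := hpos.le
  have small : ∀ {g : LaurentSeries K}, Bdd ((p : ℝ)⁻¹ ^ L) g →
      ‖g.coeff (-(k : ℤ))‖ ≤ (p : ℝ)⁻¹ ^ n * ‖(k : K)‖ := fun hg ↦ (hg _).trans hL.le
  refine (IsUltrametricDist.norm_add_le_max _ _).trans (max_le ?_ ?_)
  · rw [← HahnSeries.coeff_sum, hsum, add_mul, HahnSeries.coeff_add]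
    refine (IsUltrametricDist.norm_add_le_max _ _).trans (max_le ?_ ?_)
    · rw [Finset.sum_mul, HahnSeries.coeff_sum]
      refine IsUltrametricDist.norm_sum_le_of_forall_le_of_nonneg hb fun m _ ↦ ?_
      rw [mul_assoc, HahnSeries.C_mul_eq_smul, HahnSeries.coeff_smul, smul_eq_mul, norm_mul]
      refine (mul_le_of_le_one_left (norm_nonneg _) (hc m)).trans ?_
      have h1 := bdd_sub_theta (r := (p : ℝ)⁻¹ ^ L) (pow_le_one₀ (by positivity) hp1.le)
        (hS.bdd hq) (hτ.bdd hq) (bdd_frobeniusInvY_sq hp hx hloc L) m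
      have h2 := norm_coeff_pow_mul_theta_le hp hT hkn m
      rw [← sub_add_cancel (S ^ m * (τ * theta S)) (2 * ((S * τ) ^ (2 * m) * theta (S * τ))),
        HahnSeries.coeff_add]
      refine (IsUltrametricDist.norm_add_le_max _ _).trans (max_le (small h1) ?_)
      have h3 : (2 : LaurentSeries K) = HahnSeries.C (2 : K) := (map_ofNat HahnSeries.C 2).symm
      rw [h3, HahnSeries.C_mul_eq_smul, HahnSeries.coeff_smul, smul_eq_mul, norm_mul]
      refine (mul_le_of_le_one_left (norm_nonneg _) ?_).trans (by simpa using h2)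
      exact_mod_cast IsUltrametricDist.norm_natCast_le_one K 2
    · have h1 := ((hS.pow L).mul (hr.mono_left (q' := (p : ℝ≥0)⁻¹) zero_le)).mul
        (hτ.mul hS.theta)
      have h2 := h1.norm_coeff_le hq (k := -k) (i := L) (by
        have : (0 : ℤ) < p := by exact_mod_cast (Fact.out : p.Prime).pos
        have hk0 : (0 : ℤ) ≤ k := by positivity
        linarith)
      refine le_trans ?_ hL.le
      simpa using! h2
  · refine IsUltrametricDist.norm_tsum_le_of_forall_le fun i ↦ small ?_
    refine (hx.bdd_term (hol := hω) hp hP hyP (i + L)).mono ?_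
    exact pow_le_pow_of_le_one (by positivity) hp1.le (by omega)

end TrueCoordinates

/-! ### Comparison with the truncated coordinates -/

section Truncation

variable {p : ℕ} [Fact p.Prime] {K : Type*} [NormedField K] [NormedAlgebra ℚ_[p] K]
  [IsUltrametricDist K] {f : ℤ_[p][X]} {x z : K⟦X⟧}
  {xP yP xQ yQ : ℤ_[p]} {hω hβ : ℤ_[p][X]}

theorem coeff_trunc_coe {K : Type*} [NormedField K] (M n : ℕ) (x : K⟦X⟧) :
    PowerSeries.coeff n (PowerSeries.trunc M x : K⟦X⟧) =
      if n < M then PowerSeries.coeff n x else 0 := by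
  rw [Polynomial.coeff_coe, PowerSeries.coeff_trunc]

omit [IsUltrametricDist K] in
theorem Admissible.trunc (hx : Admissible (f.map (padicIntTo p K)) x)
    (hcx : ‖(f.map (padicIntTo p K)).eval (PowerSeries.constantCoeff x)‖ < 1) (M : ℕ) :
    Admissible (f.map (padicIntTo p K)) (PowerSeries.trunc M x : K⟦X⟧) where
  norm_le n := by
    rw [coeff_trunc_coe]
    split_ifs
    · exact hx.norm_le n
    · simp
  odd n hn := by
    rw [coeff_trunc_coe, hx.odd n hn, ite_self]
  center := by
    -- The cut-off `M = 0`, allowed when `p = 3` and `n = 1`, gives the zero series, whose centre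
    -- may lie outside the disc; then `t dx/dt = 0` makes both differentials vanish.
    rcases Nat.eq_zero_or_pos M with rfl | hM
    · right
      simp [toL]
    · left
      rwa [← PowerSeries.coeff_zero_eq_constantCoeff_apply, coeff_trunc_coe, if_pos hM,
        PowerSeries.coeff_zero_eq_constantCoeff_apply]

omit [NormedAlgebra ℚ_[p] K] [IsUltrametricDist K] in
theorem filt_sub_trunc {q : ℝ≥0} (hx : ∀ n, ‖PowerSeries.coeff n x‖ ≤ 1) (M : ℕ) :
    Filt p q M (toL x - toL (PowerSeries.trunc M x : K⟦X⟧)) := by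
  rw [← toL_sub]
  refine filt_toL (fun n ↦ ?_) fun n hn ↦ ?_
  all_goals rw [map_sub, coeff_trunc_coe]
  · split_ifs
    · simp
    · simpa using hx n
  · rw [if_pos (by exact_mod_cast hn), sub_self]

/-- For `p = 3` the leading coefficient of `θ(x - x̃)` is divisible by `3`, if it is in degree
`6 n - 6`. -/
theorem filt_theta_sub_trunc (hp : p ≠ 2) (hx : Admissible (f.map (padicIntTo p K)) x) {n M : ℕ}
    (hM : 2 * p * n ≤ M + p + 3) :
    Filt p (p : ℝ≥0)⁻¹ (2 * p * n - p - 3 + if p = 3 then 2 else 0)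
      (theta (toL x) - theta (toL (PowerSeries.trunc M x : K⟦X⟧))) := by
  have h : ∀ q : ℝ≥0, Filt p q M (toL x - toL (PowerSeries.trunc M x : K⟦X⟧)) :=
    fun q ↦ filt_sub_trunc hx.norm_le M
  rw [← map_sub]
  have hM' : (2 * p * n : ℤ) ≤ M + p + 3 := by exact_mod_cast hM
  split_ifs with h3
  · subst h3
    intro k
    rcases lt_or_ge k M with hk | hk
    · obtain ⟨i, hi⟩ := exists_le_add_mul (p := 3) (2 * (3 : ℕ) * n - (3 : ℕ) - 3 + 2) k
      exact ⟨i, hi, by rw [(h 0).theta.coeff_eq_zero hk, nnnorm_zero]; exact zero_le⟩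
    · by_cases hk2 : 6 * (n : ℤ) - 4 ≤ k
      · refine ⟨0, by push_cast; linarith, ?_⟩
        simpa [← NNReal.coe_le_coe] using (h 0).theta.norm_coeff_le_one zero_le k
      · push_cast at hM'
        -- Only two degrees fall below the improved level: in `6n - 6` the derivation supplies a
        -- factor 3, and `6n - 5` is odd.
        obtain rfl | rfl : k = 6 * (n : ℤ) - 6 ∨ k = 6 * (n : ℤ) - 5 := by omega
        · refine ⟨1, by push_cast; linarith, ?_⟩
          rw [← NNReal.coe_le_coe, coe_nnnorm, coeff_theta, norm_mul]
          have e : ((6 * (n : ℤ) - 6 : ℤ) : K) = ((3 : ℕ) : K) * ((2 * (n : ℤ) - 2 : ℤ) : K) := by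
            push_cast; ring
          rw [e, norm_mul, norm_prime (p := 3) K, mul_assoc]
          have h4 : ‖((2 * (n : ℤ) - 2 : ℤ) : K)‖ ≤ 1 := IsUltrametricDist.norm_intCast_le_one K _
          have h5 := (h 0).norm_coeff_le_one zero_le (6 * (n : ℤ) - 6)
          have := mul_le_one₀ h4 (norm_nonneg _) h5
          rw [pow_one, NNReal.coe_inv, NNReal.coe_natCast]
          exact mul_le_of_le_one_right (by positivity) this
        · refine ⟨1, by push_cast; linarith, ?_⟩
          have hn : 0 ≤ 6 * (n : ℤ) - 5 := le_trans (by positivity) hk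
          have ho : Odd (6 * n - 5) := ⟨3 * n - 3, by omega⟩
          rw [coeff_theta, ← toL_sub, show 6 * (n : ℤ) - 5 = ((6 * n - 5 : ℕ) : ℤ) by omega,
            coeff_toL_natCast, map_sub, coeff_trunc_coe, hx.odd _ ho]
          simp
  · exact (h _).theta.mono (by linarith)

/-- For `v = v(k) ≥ 1` this rests on `k ≥ p^v ≥ p + 2p(v - 1)`. Without the correction one needs `p
> 3`, and `k = p = 3` would fail. -/
theorem exponent_bound (hp : p ≠ 2) (n : ℕ) {k : ℕ} (hk : k ≠ 0) :
    2 * p * (((n + padicValNat p k : ℕ) : ℤ) - 1) - k <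
      2 * p * n - p - 3 + (if p = 3 then 2 else 0) + p := by
  have hp' := (Fact.out : p.Prime)
  have h2 := hp'.two_le
  have hk1 : 1 ≤ k := by omega
  have hle : p ^ padicValNat p k ≤ k := Nat.le_of_dvd (by omega) pow_padicValNat_dvd
  rcases hv : padicValNat p k with _ | v
  · push_cast
    split_ifs <;> nlinarith
  · rw [hv, pow_succ] at hle
    have hb : 1 + v * (p - 1) ≤ p ^ v := by
      have := one_add_mul_le_pow (a := ((p : ℤ) - 1)) (by omega) v
      zify [hp'.one_le]
      simpa using this
    have h5 : p = 3 ∨ 4 ≤ p := by omega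
    have key : (p : ℤ) + 2 * p * v ≤ k := by
      obtain ⟨r, rfl⟩ : ∃ r, p = r + 3 := ⟨p - 3, by omega⟩
      have e : r + 3 - 1 = r + 2 := by omega
      rw [e] at hb
      have : (r + 3) * (1 + v * (r + 2)) ≤ k := (by nlinarith : _ ≤ _).trans hle
      zify at this
      push_cast
      nlinarith [mul_nonneg (Int.natCast_nonneg v) (Int.natCast_nonneg r),
        mul_nonneg (mul_nonneg (Int.natCast_nonneg v) (Int.natCast_nonneg r))
          (Int.natCast_nonneg r)]
    push_cast
    rcases h5 with h5 | h5
    · rw [if_pos h5]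
      have : (p : ℤ) = 3 := by exact_mod_cast h5
      rw [this] at key ⊢
      linarith
    · rw [if_neg (by omega)]
      have : (4 : ℤ) ≤ p := by exact_mod_cast h5
      linarith

/-- A change of `x` in degrees at least `M` alters `t² β/dt` only in degrees at least `M`, and `b_k`
uses its coefficient in degree `k + 1`. -/
theorem primitiveCoeff_sub_trunc (hQ : yQ ^ 2 = f.eval xQ) (hyQ : IsUnit yQ)
    (hx : Admissible (f.map (padicIntTo p K)) x)
    (hcx : ‖(f.map (padicIntTo p K)).eval (PowerSeries.constantCoeff x)‖ < 1) {M : ℕ} (c c' : K)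
    {k : ℕ} (hk : k ≠ 0) (hkM : k + 1 < M) :
    primitiveCoeff (diffOfPadicInt K xQ yQ hβ) c x PowerSeries.X k =
      primitiveCoeff (diffOfPadicInt K xQ yQ hβ) c' (PowerSeries.trunc M x : K⟦X⟧)
        PowerSeries.X k := by
  have hz := hx.trunc hcx M
  have hcz : ‖(f.map (padicIntTo p K)).eval
      (PowerSeries.constantCoeff (PowerSeries.trunc M x : K⟦X⟧))‖ < 1 := by
    rwa [← PowerSeries.coeff_zero_eq_constantCoeff_apply, coeff_trunc_coe,
      if_pos (by omega), PowerSeries.coeff_zero_eq_constantCoeff_apply]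
  have hd : Filt p 0 M (toL x - toL (PowerSeries.trunc M x : K⟦X⟧)) := filt_sub_trunc hx.norm_le M
  have h : Filt p 0 M (HahnSeries.single 1 1 ^ 2 *
      ((diffOfPadicInt K xQ yQ hβ).expand x PowerSeries.X -
      (diffOfPadicInt K xQ yQ hβ).expand (PowerSeries.trunc M x : K⟦X⟧) PowerSeries.X)) := by
    have key : ∀ P Q X Z : LaurentSeries K,
      P * X - Q * Z = P * (X - Z) + (P - Q) * Z := fun P Q X Z ↦ by ring
    rw [mul_sub, single_mul_expand, single_mul_expand, key, ← map_sub]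
    refine Filt.add ?_ ?_
    · exact ((filt_rat hQ hyQ hx.norm_le hcx).mul hd.theta).mono (by simp)
    · exact ((filt_rat_sub hQ hyQ hx.norm_le hcx hz.norm_le hcz hd).mul hz.filt_theta).mono
        (by linarith)
  have h0 := h.coeff_eq_zero (k := k + 1) (by exact_mod_cast hkM)
  rw [coeff_single_one_pow_two_mul, HahnSeries.coeff_sub, sub_eq_zero,
    show (k : ℤ) + 1 - 2 = k - 1 by ring] at h0
  have hk' : (k : ℤ) ≠ 0 := by exact_mod_cast hk
  rw [primitiveCoeff, primitiveCoeff, if_neg hk', if_neg hk', h0]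

theorem norm_residue_sub_le [CompleteSpace K] (hp : p ≠ 2) (hf : f.Monic)
    (hgood : (f.map (PadicInt.toZMod (p := p))).Separable)
    (hP : yP ^ 2 = f.eval xP) (hyP : IsUnit yP) (hQ : yQ ^ 2 = f.eval xQ) (hyQ : IsUnit yQ)
    (hx : Admissible (f.map (padicIntTo p K)) x) {a : K}
    (hloc : IsLocalCoordinates (f.map (padicIntTo p K)) a x PowerSeries.X)
    (ha : (f.map (padicIntTo p K)).eval a = 0) {n M : ℕ} (hM : 2 * p * n ≤ M + p + 3) (c c' : K) :
    ‖residue p (f.map (padicIntTo p K)) (diffOfPadicInt K xP yP hω) (diffOfPadicInt K xQ yQ hβ)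
        c x PowerSeries.X -
      residue p (f.map (padicIntTo p K)) (diffOfPadicInt K xP yP hω) (diffOfPadicInt K xQ yQ hβ)
        c' (PowerSeries.trunc M x : K⟦X⟧) PowerSeries.X‖ ≤ (p : ℝ)⁻¹ ^ n := by
  have hcx : ‖(f.map (padicIntTo p K)).eval (PowerSeries.constantCoeff x)‖ < 1 := by
    rw [hloc.center, ha, norm_zero]; exact one_pos
  have hz := hx.trunc hcx M
  have hM' : (2 * p * n : ℤ) ≤ M + p + 3 := by exact_mod_cast hM
  have hsx := (hx.residueConverges (hω := hω) (hβ := hβ) hp hP hyP hQ hyQ c).summable_residue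
  have hsz := (hz.residueConverges (hω := hω) (hβ := hβ) hp hP hyP hQ hyQ c').summable_residue
  rw [residue, residue, ← hsx.tsum_sub hsz]
  refine IsUltrametricDist.norm_tsum_le_of_forall_le fun k ↦ ?_
  rcases lt_trichotomy k 0 with hk | rfl | hk
  · rw [hx.primitiveCoeff_of_neg hQ hyQ _ hk, hz.primitiveCoeff_of_neg hQ hyQ _ hk]
    simp
  · rw [sub_zero, hx.alphaCoeff_neg_one hp hP hyP, hz.alphaCoeff_neg_one hp hP hyP]
    simp
  lift k to ℕ using hk.le
  have hk0 : k ≠ 0 := by rintro rfl; simp at hk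
  have hkpos : 0 < ‖(k : K)‖ := norm_pos_iff.2 (natCast_ne_zero_of_pos p K hk0)
  have key : ∀ A B P Q : K, A * P - B * Q = A * (P - Q) + (A - B) * Q := fun A B P Q ↦ by ring
  have h1 := hx.norm_primitiveCoeff_le (hβ := hβ) hQ hyQ c hk0
  have h2 := hz.norm_primitiveCoeff_le (hβ := hβ) hQ hyQ c' hk0
  have cancel : (p : ℝ)⁻¹ ^ n * ‖(k : K)‖ * ‖(k : K)‖⁻¹ = (p : ℝ)⁻¹ ^ n :=
    mul_inv_cancel_right₀ hkpos.ne' _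
  rw [key]
  refine (IsUltrametricDist.norm_add_le_max _ _).trans (max_le ?_ ?_)
  · by_cases hkM : k + 1 < M
    · rw [primitiveCoeff_sub_trunc hQ hyQ hx hcx c c' hk0 hkM, sub_self, mul_zero, norm_zero]
      positivity
    -- Here `k ≥ M - 1 ≥ 2pn - p - 4`, exactly the range in which the sharper bound on `α` holds.
    · rw [norm_mul, ← cancel]
      have hkn : (2 * p * n - p - 4 : ℤ) ≤ k := by
        have : (M : ℤ) ≤ k + 1 := by exact_mod_cast not_lt.1 hkM
        linarith
      exact mul_le_mul (norm_alphaCoeff_le_mul_norm hp hf hgood hP hyP hx hloc ha hk0 hkn)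
        ((norm_sub_le_max_of_ultrametric _ _).trans (max_le h1 h2)) (norm_nonneg _) (by positivity)
  · rw [norm_mul, ← cancel]
    have h3 := norm_alphaCoeff_sub_le (hω := hω) hp hP hyP hx hcx hz (filt_sub_trunc hx.norm_le M)
      (filt_theta_sub_trunc hp hx hM) (by split_ifs <;> linarith) (k := k) (by positivity)
      (exponent_bound hp n hk0)
    rw [pow_add, ← norm_natCast_eq_pow K hk0] at h3
    exact mul_le_mul h3 h2 (norm_nonneg _) (by positivity)

end Truncation

end HyperellipticResidue

end

open HyperellipticResidue in
theorem mainTheorem3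
    (p : ℕ) [Fact p.Prime] (hp : p ≠ 2)
    -- the hyperelliptic curve `y² = f(x)` of genus `g` over `ℤ_p`, with good reduction
    (g : ℕ) (hg : 1 ≤ g) (f : ℤ_[p][X]) (hf : f.Monic) (hdeg : f.natDegree = 2 * g + 1)
    (hgood : (f.map (PadicInt.toZMod (p := p))).Separable)
    -- the points `P`, `Q` in finite non-Weierstrass residue discs
    (xP yP xQ yQ : ℤ_[p]) (hP : yP ^ 2 = f.eval xP) (hQ : yQ ^ 2 = f.eval xQ)
    (hyP : IsUnit yP) (hyQ : IsUnit yQ)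
    -- the holomorphic parts of `ω` and `β`
    (hω hβ : ℤ_[p][X]) (hωdeg : hω.degree < (g : WithBot ℕ)) (hβdeg : hβ.degree < (g : WithBot ℕ))
    -- the Weierstrass point `A = (a, 0)`, over an extension of `ℚ_p`
    (K : Type*) [NormedField K] [NormedAlgebra ℚ_[p] K] [IsUltrametricDist K] [CompleteSpace K]
    (a : K) (haf : Polynomial.eval a (f.map (padicIntTo p K)) = 0) (ha : a ≠ 0)
    (n : ℕ) (hn : 1 ≤ n) :
    (∃! x : K⟦X⟧, IsLocalCoordinates (f.map (padicIntTo p K)) a x PowerSeries.X) ∧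
    ∀ x y : K⟦X⟧, IsLocalCoordinates (f.map (padicIntTo p K)) a x y →
      ∀ c : K,
        ResidueConverges p (f.map (padicIntTo p K)) (diffOfPadicInt K xP yP hω)
          (diffOfPadicInt K xQ yQ hβ) c x y ∧
        ∀ (M : ℕ) (_ : 2 * p * n - p - 3 ≤ M) (c' : K),
          ResidueConverges p (f.map (padicIntTo p K)) (diffOfPadicInt K xP yP hω)
            (diffOfPadicInt K xQ yQ hβ) c' (PowerSeries.trunc M x : K[X]) y ∧
          ‖residue p (f.map (padicIntTo p K)) (diffOfPadicInt K xP yP hω)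
              (diffOfPadicInt K xQ yQ hβ) c x y -
            residue p (f.map (padicIntTo p K)) (diffOfPadicInt K xP yP hω)
              (diffOfPadicInt K xQ yQ hβ) c' (PowerSeries.trunc M x : K[X]) y‖
            ≤ (p : ℝ) ^ (-(n : ℤ)) := by
  obtain ⟨x₀, hint, hloc₀, huniq⟩ := existsUnique_localCoordinates (K := K) hf (by omega) hgood haf
  refine ⟨⟨x₀, hloc₀, fun z hz ↦ huniq z _ hz⟩, fun x y hxy c ↦ ?_⟩
  obtain rfl := hxy.parameter
  obtain rfl := huniq x _ hxy
  have hcx : ‖(f.map (padicIntTo p K)).eval (PowerSeries.constantCoeff x)‖ < 1 := by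
    rw [hxy.center, haf, norm_zero]; exact one_pos
  have hx : Admissible (f.map (padicIntTo p K)) x :=
    ⟨hint, fun n hn ↦ hxy.coeff_eq_zero_of_odd hf hgood haf hn, Or.inl hcx⟩
  refine ⟨hx.residueConverges hp hP hyP hQ hyQ c, fun M hM c' ↦
    ⟨(hx.trunc hcx M).residueConverges hp hP hyP hQ hyQ c', ?_⟩⟩
  rw [zpow_neg, zpow_natCast, ← inv_pow]
  exact norm_residue_sub_le hp hf hgood hP hyP hQ hyQ hx hxy haf (by omega) c c'
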